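/- **Notation.** Work over $\mathbb{Q}$. For $n\ge 0$ let $[n]=\{1,\dots,n\}$, and write $\pi\vdash[n]$ if $\pi$ is a set partition of $[n]$; set partitions are ordered by refinement, with greatest lower bound $\wedge$; $[\![k]\!]$ denotes the set partition of $[k]$ with the single block $[k]$ (no block if $k=0$). Let $\lambda(\pi)=\lambda_1\lambda_2\cdots\lambda_{\ell(\pi)}$ be the integer partition formed by the block sizes of $\pi$ in weakly decreasing order, $\ell(\pi)$ the number of blocks, and $\lambda(\pi)!=\prod_i\lambda_i!$. Let $\mathrm{NCSym}$ be the algebra of power series of bounded degree in noncommuting variables $x_1,x_2,\dots$ that are invariant under all permutations of the variables. For $\pi\vdash[n]$ let $$m_\pi=\sum x_{i_1}\cdots x_{i_n}\quad\text{over all tuples with } i_j=i_k \iff j,k \text{ are in the same block of }\pi,$$ $$e_\pi=\sum x_{i_1}\cdots x_{i_n}\quad\text{over all tuples with } i_j\ne i_k \text{ whenever } j\neq k \text{ are in the same block of }\pi,$$ $$h_\pi=\sum_{\sigma\vdash[n]}\lambda(\sigma\wedge\pi)!\,m_\sigma .$$ The $h_\pi$ ($\pi\vdash[n]$, $n\ge0$)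 form a basis of $\mathrm{NCSym}$, and $\omega$ is the linear map on $\mathrm{NCSym}$ with $\omega(h_\pi)=e_\pi$ for all $\pi$. A permutation $\delta\in\mathfrak S_n$ acts linearly on the homogeneous part of degree $n$ of $\mathrm{NCSym}$ by $\delta\circ m_\pi=m_{\delta\pi}$, where the blocks of $\delta\pi$ are the images $\delta(B)$ of the blocks $B$ of $\pi$. The map $\rho:\mathbb{Q}\langle\langle x_1,x_2,\dots\rangle\rangle\to\mathbb{Q}[[x_1,x_2,\dots]]$ lets the variables commute. For a $k\times k$ matrix with noncommuting entries put $\mathbf{det}(a_{ij})=\sum_{\varepsilon\in\mathfrak S_k}\mathrm{sgn}(\varepsilon)\,a_{1\varepsilon(1)}a_{2\varepsilon(2)}\cdots a_{k\varepsilon(k)}$. For $\pi\vdash[n]$ let $\delta_\pi\in\mathfrak S_n$ be the permutation whose one-line notation lists the blocks of $\pi$ by weakly decreasing size, blocks of equal size by increasing least element, and the elements of each block in increasing order. Put $$s_\pi=\delta_\pi\circ\mathbf{det}\left(\frac{1}{(\lambda_i-i+j)!}\,h_{[\![\lambda_i-i+j]\!]}\right)_{1\le i,j\le\ell(\pi)},\qquad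 s^t_\pi=\omega(s_\pi),$$ where $\lambda(\pi)=\lambda_1\cdots\lambda_{\ell(\pi)}$, and entries with $\lambda_i-i+j<0$ are $0$. For an integer partition $\mu$ let $s_\mu=\det(h_{\mu_i-i+j})_{1\le i,j\le\ell(\mu)}$ be the classical Schur function, where $h_k$ is the complete homogeneous symmetric function ($h_0=1$, and $h_k=0$ for $k<0$), and let $\mu^t$ be the transpose of $\mu$. **Theorem.** For every set partition $\pi$ with $\lambda(\pi)=\lambda_1\lambda_2\cdots\lambda_{\ell(\pi)}$, $$s^t_\pi=\delta_\pi\circ\mathbf{det}\left(\frac{1}{(\lambda_i-i+j)!}\,e_{[\![\lambda_i-i+j]\!]}\right)_{1\le i,j\le\ell(\pi)},$$ where entries with $\lambda_i-i+j<0$ are $0$. The family $\{s^t_\pi\}_{\pi\vdash[n],\,n\ge0}$ is a basis of $\mathrm{NCSym}$ (for $n=0$ it contributes the single element $s^t_\emptyset=1$). Moreover, for every set partition $\pi$, $$\rho(s^t_\pi)=s_{\lambda(\pi)^t}.$$ -/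

import Mathlib

open Finset Equiv

noncomputable section

/-! ### Formal power series in noncommuting variables -/

/-- The `ℚ`-vector space of formal power series `ℚ⟨⟨x₀, x₁, x₂, …⟩⟩` in noncommuting variables.
The word `[i₁, …, iₙ]` stands for the monomial `x_{i₁} ⋯ x_{iₙ}`, and a series is
given by its coefficients. -/
@[ext]
structure NCSeries where
  /-- The coefficient of a word. -/
  coeff : List ℕ → ℚ

namespace NCSeries

/-- A series is the same thing as its family of coefficients. -/
def equivFun : NCSeries ≃ (List ℕ → ℚ) := ⟨coeff, mk, fun _ => rfl, fun _ => rfl⟩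

/-- Addition and scalar multiplication are coefficientwise. -/
instance : AddCommGroup NCSeries := equivFun.addCommGroup

instance : Module ℚ NCSeries := equivFun.module ℚ

instance : One NCSeries := ⟨⟨fun w => if w = [] then 1 else 0⟩⟩

/-- The concatenation product: sum over all factorizations of the word `w` into two words. -/
instance : Mul NCSeries :=
  ⟨fun f g => ⟨fun w => ∑ k ∈ range (w.length + 1), f.coeff (w.take k) * g.coeff (w.drop k)⟩⟩

theorem ext_coeff {f g : NCSeries} (h : ∀ w, f.coeff w = g.coeff w) : f = g :=
  NCSeries.ext (funext h)

@[simp] theorem coeff_zero (w : List ℕ) : (0 : NCSeries).coeff w = 0 := rfl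

@[simp] theorem coeff_add (f g : NCSeries) (w : List ℕ) :
    (f + g).coeff w = f.coeff w + g.coeff w := rfl

@[simp] theorem coeff_smul (c : ℚ) (f : NCSeries) (w : List ℕ) :
    (c • f).coeff w = c * f.coeff w := rfl

theorem coeff_one (w : List ℕ) : (1 : NCSeries).coeff w = if w = [] then 1 else 0 := rfl

theorem coeff_mul (f g : NCSeries) (w : List ℕ) :
    (f * g).coeff w = ∑ k ∈ range (w.length + 1), f.coeff (w.take k) * g.coeff (w.drop k) := rfl

theorem coeff_sum {ι : Type*} (s : Finset ι) (f : ι → NCSeries) (w : List ℕ) :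
    (∑ i ∈ s, f i).coeff w = ∑ i ∈ s, (f i).coeff w :=
  map_sum (⟨⟨fun f : NCSeries => f.coeff w, rfl⟩, fun _ _ => rfl⟩ : NCSeries →+ ℚ) f s

theorem coeff_mul_nil (f g : NCSeries) : (f * g).coeff [] = f.coeff [] * g.coeff [] := by
  simp [coeff_mul]

/-- The series of those terms of `f` that start with `x_a`, with this first letter removed. -/
def shift (f : NCSeries) (a : ℕ) : NCSeries := ⟨fun v => f.coeff (a :: v)⟩

@[simp] theorem coeff_shift (f : NCSeries) (a : ℕ) (v : List ℕ) :
    (f.shift a).coeff v = f.coeff (a :: v) := rfl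

theorem coeff_mul_cons (f g : NCSeries) (a : ℕ) (w : List ℕ) :
    (f * g).coeff (a :: w) = f.coeff [] * g.coeff (a :: w) + (f.shift a * g).coeff w := by
  simp only [coeff_mul, List.length_cons]
  rw [sum_range_succ', add_comm]
  simp

protected theorem add_mul (f g h : NCSeries) : (f + g) * h = f * h + g * h := by
  refine ext_coeff fun w => ?_
  simp [coeff_mul, add_mul, sum_add_distrib]

protected theorem mul_add (f g h : NCSeries) : f * (g + h) = f * g + f * h := by
  refine ext_coeff fun w => ?_
  simp [coeff_mul, mul_add, sum_add_distrib]

protected theorem smul_mul (c : ℚ) (f g : NCSeries) : (c • f) * g = c • (f * g) := by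
  refine ext_coeff fun w => ?_
  simp [coeff_mul, mul_assoc, mul_sum]

protected theorem mul_smul (c : ℚ) (f g : NCSeries) : f * (c • g) = c • (f * g) := by
  refine ext_coeff fun w => ?_
  simp [coeff_mul, mul_left_comm, mul_sum]

protected theorem mul_assoc (f g h : NCSeries) : f * g * h = f * (g * h) := by
  refine ext_coeff fun w => ?_
  induction w generalizing f with
  | nil => simp [coeff_mul_nil, mul_assoc]
  | cons a w ih =>
    have key : (f * g).shift a = f.coeff [] • g.shift a + f.shift a * g :=
      ext_coeff fun v => by simp [coeff_mul_cons]
    rw [coeff_mul_cons, key, NCSeries.add_mul, NCSeries.smul_mul, coeff_add, ih,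
      coeff_mul_cons f, coeff_mul_cons g, coeff_mul_nil, coeff_smul]
    ring

instance : Ring NCSeries :=
  { (inferInstance : AddCommGroup NCSeries),
    (inferInstance : One NCSeries), (inferInstance : Mul NCSeries) with
    left_distrib := NCSeries.mul_add
    right_distrib := NCSeries.add_mul
    mul_assoc := NCSeries.mul_assoc
    zero_mul := fun f => ext_coeff fun w => by simp [coeff_mul]
    mul_zero := fun f => ext_coeff fun w => by simp [coeff_mul]
    one_mul := fun f => ext_coeff fun w => by
      cases w with
      | nil => simp [coeff_mul_nil, coeff_one]
      | cons a w => simp [coeff_one, coeff_mul]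
    mul_one := fun f => ext_coeff fun w => by
      induction w generalizing f with
      | nil => simp [coeff_mul_nil, coeff_one]
      | cons a w ih => rw [coeff_mul_cons, ih]; simp [coeff_one] }

instance : Algebra ℚ NCSeries := Algebra.ofModule NCSeries.smul_mul NCSeries.mul_smul

end NCSeries

/-! ### The algebra of symmetric functions in noncommuting variables -/

/-- `NCSym`: the noncommutative power series of bounded degree that are invariant under all
permutations of the variables. -/
def NCSym : Subalgebra ℚ NCSeries where
  carrier := {f | (∃ N, ∀ w : List ℕ, N < w.length → f.coeff w = 0) ∧
    ∀ (τ : Perm ℕ) (w : List ℕ), f.coeff (w.map τ) = f.coeff w}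
  mul_mem' := by
    rintro f g ⟨⟨M, hM⟩, hf⟩ ⟨⟨N, hN⟩, hg⟩
    refine ⟨⟨M + N, fun w hw => ?_⟩, fun τ w => ?_⟩
    · rw [NCSeries.coeff_mul]
      refine sum_eq_zero fun k hk => ?_
      rw [mem_range] at hk
      rcases lt_or_ge M k with h | h
      · rw [hM _ (by rw [List.length_take]; omega), zero_mul]
      · rw [hN _ (by rw [List.length_drop]; omega), mul_zero]
    · simp only [NCSeries.coeff_mul, List.length_map, ← List.map_take, ← List.map_drop, hf, hg]
  add_mem' := by
    rintro f g ⟨⟨M, hM⟩, hf⟩ ⟨⟨N, hN⟩, hg⟩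
    refine ⟨⟨max M N, fun w hw => ?_⟩, fun τ w => ?_⟩
    · rw [max_lt_iff] at hw
      simp [hM w hw.1, hN w hw.2]
    · simp [hf, hg]
  algebraMap_mem' := by
    intro c
    rw [Algebra.algebraMap_eq_smul_one]
    refine ⟨⟨0, fun w hw => ?_⟩, fun τ w => ?_⟩
    · simp [NCSeries.coeff_one, List.length_pos_iff.mp hw]
    · simp [NCSeries.coeff_one]

/-- Set partitions of `[n]` (realized as `Fin n`). The order is refinement, `⊓` is the greatest
lower bound and `⊤` is the partition with at most one block. -/
abbrev SetPartition (n : ℕ) : Type := Finpartition (univ : Finset (Fin n))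

namespace NCSym

/-- The series `∑ x_{i₁} ⋯ x_{iₙ}` over all tuples `(i₁, …, iₙ)` that satisfy `P`. -/
def tupleSeries {n : ℕ} (P : (Fin n → ℕ) → Prop) : NCSeries := by
  classical
  exact ⟨fun w => if ∃ i : Fin n → ℕ, P i ∧ w = List.ofFn i then 1 else 0⟩

theorem tupleSeries_ofFn {n : ℕ} (P : (Fin n → ℕ) → Prop) (i : Fin n → ℕ) [Decidable (P i)] :
    (tupleSeries P).coeff (List.ofFn i) = if P i then 1 else 0 := by
  classical
  unfold tupleSeries
  refine if_congr ⟨?_, fun h => ⟨i, h, rfl⟩⟩ rfl rfl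
  rintro ⟨i', h, h'⟩
  rwa [List.ofFn_injective h']

theorem tupleSeries_of_length_ne {n : ℕ} (P : (Fin n → ℕ) → Prop) {w : List ℕ}
    (hw : w.length ≠ n) : (tupleSeries P).coeff w = 0 := by
  unfold tupleSeries
  refine if_neg ?_
  rintro ⟨i, -, rfl⟩
  simp at hw

theorem tupleSeries_mem {n : ℕ} (P : (Fin n → ℕ) → Prop)
    (hP : ∀ (τ : Perm ℕ) (i : Fin n → ℕ), P (τ ∘ i) ↔ P i) : tupleSeries P ∈ NCSym := by
  classical
  refine ⟨⟨n, fun w hw => tupleSeries_of_length_ne P hw.ne'⟩, fun τ w => ?_⟩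
  by_cases hw : w.length = n
  · obtain ⟨i, rfl⟩ : ∃ i : Fin n → ℕ, w = List.ofFn i := by
      subst hw
      exact ⟨w.get, (List.ofFn_get w).symm⟩
    rw [List.map_ofFn, tupleSeries_ofFn, tupleSeries_ofFn]
    exact if_congr (hP τ i) rfl rfl
  · rw [tupleSeries_of_length_ne P hw, tupleSeries_of_length_ne P (by simpa using hw)]

variable {n : ℕ}

/-- Monomial function: `i_j = i_k` if and only if `j` and `k` are in the same block. -/
def m (π : SetPartition n) : NCSym :=
  ⟨tupleSeries fun i => ∀ j k, i j = i k ↔ π.part j = π.part k,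
    tupleSeries_mem _ fun τ i => by simp⟩

/-- Elementary function: `i_j ≠ i_k` whenever `j ≠ k` are in the same block. -/
def e (π : SetPartition n) : NCSym :=
  ⟨tupleSeries fun i => ∀ j k, j ≠ k → π.part j = π.part k → i j ≠ i k,
    tupleSeries_mem _ fun τ i => by simp⟩

/-- `λ(π)! = ∏ |B|!`, the product over the blocks `B` of `π`. -/
def blockFactorial (π : SetPartition n) : ℕ := ∏ B ∈ π.parts, (B.card).factorial

/-- Complete homogeneous function: `h_π = ∑_σ λ(σ ∧ π)! m_σ`. -/
def h (π : SetPartition n) : NCSym := ∑ σ : SetPartition n, (blockFactorial (σ ⊓ π) : ℚ) • m σ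

/-! ### The complete homogeneous functions form a basis of `NCSym`

This is needed to define the linear map `ω`. -/

theorem part_inf (σ π : SetPartition n) (x : Fin n) :
    (σ ⊓ π).part x = σ.part x ∩ π.part x := by
  have hx : x ∈ σ.part x ∩ π.part x :=
    mem_inter.2 ⟨σ.mem_part (mem_univ x), π.mem_part (mem_univ x)⟩
  refine Finpartition.part_eq_of_mem _ ?_ hx
  rw [Finpartition.parts_inf, mem_erase, mem_image]
  exact ⟨Finset.ne_empty_of_mem hx, (σ.part x, π.part x),
    mem_product.2 ⟨σ.part_mem.2 (mem_univ x), π.part_mem.2 (mem_univ x)⟩, rfl⟩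

theorem part_eq_iff (π : SetPartition n) (x y : Fin n) :
    π.part x = π.part y ↔ x ∈ π.part y :=
  (π.mem_part_iff_part_eq_part (mem_univ x) (mem_univ y)).symm

theorem part_inf_eq_iff (σ π : SetPartition n) (x y : Fin n) :
    (σ ⊓ π).part x = (σ ⊓ π).part y ↔ σ.part x = σ.part y ∧ π.part x = π.part y := by
  rw [part_eq_iff, part_inf, mem_inter, part_eq_iff, part_eq_iff]

theorem setPartition_ext {σ π : SetPartition n} (hσ : ∀ x y, σ.part x = σ.part y ↔
    π.part x = π.part y) : σ = π := by
  have key : ∀ x, σ.part x = π.part x := fun x => by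
    ext y
    rw [← part_eq_iff, ← part_eq_iff, hσ]
  ext B
  constructor
  · intro hB
    obtain ⟨x, hx⟩ := σ.nonempty_of_mem_parts hB
    rw [← σ.part_eq_of_mem hB hx, key]
    exact π.part_mem.2 (mem_univ x)
  · intro hB
    obtain ⟨x, hx⟩ := π.nonempty_of_mem_parts hB
    rw [← π.part_eq_of_mem hB hx, ← key]
    exact σ.part_mem.2 (mem_univ x)

theorem le_iff_part (σ π : SetPartition n) :
    σ ≤ π ↔ ∀ x y, σ.part x = σ.part y → π.part x = π.part y := by
  constructor
  · intro hle x y hxy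
    obtain ⟨C, hC, hBC⟩ := hle (σ.part_mem.2 (mem_univ y))
    rw [π.part_eq_of_mem hC (hBC ((part_eq_iff σ x y).1 hxy)),
      π.part_eq_of_mem hC (hBC (σ.mem_part (mem_univ y)))]
  · intro hxy B hB
    obtain ⟨x, hx⟩ := σ.nonempty_of_mem_parts hB
    refine ⟨π.part x, π.part_mem.2 (mem_univ x), fun y hy => ?_⟩
    rw [← part_eq_iff]
    apply hxy
    rw [σ.part_eq_of_mem hB hx, σ.part_eq_of_mem hB hy]

theorem blockFactorial_eq_card (π : SetPartition n) :
    blockFactorial π = (univ.filter fun g : Perm (Fin n) => ∀ x, π.part (g x) = π.part x).card := by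
  classical
  have h1 := DomMulAct.stabilizer_card' (f := π.part)
  have h2 : (univ : Finset (Fin n)).image π.part = π.parts := by
    ext B
    constructor
    · intro hB
      obtain ⟨x, -, rfl⟩ := mem_image.1 hB
      exact π.part_mem.2 (mem_univ x)
    · intro hB
      obtain ⟨x, hx⟩ := π.nonempty_of_mem_parts hB
      exact mem_image.2 ⟨x, mem_univ x, π.part_eq_of_mem hB hx⟩
  rw [h2] at h1
  have h3 : blockFactorial π = ∏ B ∈ π.parts, (Fintype.card {a // π.part a = B}).factorial := by
    refine prod_congr rfl fun B hB => ?_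
    rw [Fintype.card_subtype]
    congr 2
    ext x
    simp [π.part_eq_iff_mem hB]
  rw [h3, ← h1, Fintype.card_subtype]
  congr 1
  ext g
  simp [funext_iff]

/-- A permutation whose cycles are the blocks of `π`. -/
theorem exists_perm_cycles (π : SetPartition n) : ∃ g : Perm (Fin n),
    (∀ x, π.part (g x) = π.part x) ∧
    ∀ σ : SetPartition n, (∀ x, σ.part (g x) = σ.part x) → π ≤ σ := by
  choose c hc using fun B : Finset (Fin n) => B.exists_cycleOn
  have hpart : ∀ x, π.part (c (π.part x) x) = π.part x := fun x => by
    rw [part_eq_iff]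
    exact (hc (π.part x)).1.1.mapsTo (π.mem_part (mem_univ x))
  have hinj : Function.Injective fun x => c (π.part x) x := by
    intro x y hxy
    have hxy' : c (π.part x) x = c (π.part y) y := hxy
    have : π.part x = π.part y := by rw [← hpart x, ← hpart y, hxy']
    rw [this] at hxy'
    exact (c (π.part y)).injective hxy'
  let g : Perm (Fin n) := Equiv.ofBijective _ (Finite.injective_iff_bijective.1 hinj)
  have hg : ∀ x, g x = c (π.part x) x := fun x => rfl
  refine ⟨g, fun x => by rw [hg, hpart], fun σ hσ => (le_iff_part π σ).2 fun x y hxy => ?_⟩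
  have hx : x ∈ (π.part y : Set (Fin n)) := (part_eq_iff π x y).1 hxy
  have hy : y ∈ (π.part y : Set (Fin n)) := π.mem_part (mem_univ y)
  obtain ⟨N, hN⟩ := (hc (π.part y)).1.exists_pow_eq hx hy
  have hpow : ∀ k : ℕ, π.part ((c (π.part y) ^ k) x) = π.part y ∧
      σ.part ((c (π.part y) ^ k) x) = σ.part x := by
    intro k
    induction k with
    | zero => exact ⟨hxy, rfl⟩
    | succ k ih =>
      rw [pow_succ', Perm.mul_apply]
      have : c (π.part y) ((c (π.part y) ^ k) x) = g ((c (π.part y) ^ k) x) := by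
        rw [hg, ih.1]
      rw [this, hσ]
      refine ⟨?_, ih.2⟩
      rw [hg, hpart, ih.1]
  rw [← (hpow N).2, hN.2]

/-- The matrix `(λ(σ ∧ π)!)` of coefficients of `h_π` in the `m_σ` has independent columns. -/
theorem linearIndependent_coeff :
    LinearIndependent ℚ fun π : SetPartition n =>
      (fun σ : SetPartition n => (blockFactorial (σ ⊓ π) : ℚ)) := by
  classical
  rw [Fintype.linearIndependent_iff]
  intro c hc
  have hcσ : ∀ σ : SetPartition n, ∑ π, c π * (blockFactorial (σ ⊓ π) : ℚ) = 0 := fun σ => by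
    simpa using congrFun hc σ
  let Y : SetPartition n → Perm (Fin n) → ℚ :=
    fun π g => if ∀ x, π.part (g x) = π.part x then 1 else 0
  have hY : ∀ σ π : SetPartition n, (blockFactorial (σ ⊓ π) : ℚ) = ∑ g, Y σ g * Y π g := by
    intro σ π
    rw [blockFactorial_eq_card, card_filter]
    push_cast
    refine sum_congr rfl fun g _ => ?_
    simp only [Y, part_inf_eq_iff, forall_and]
    split_ifs <;> simp_all
  have hsq : ∑ g, (∑ π, c π * Y π g) ^ 2 = 0 := by
    have h1 : ∑ σ, c σ * ∑ π, c π * (blockFactorial (σ ⊓ π) : ℚ) = 0 := by simp [hcσ]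
    rw [← h1]
    simp only [hY, sq, mul_sum]
    simp only [sum_mul]
    rw [sum_comm]
    refine sum_congr rfl fun σ _ => ?_
    rw [sum_comm]
    refine sum_congr rfl fun π _ => sum_congr rfl fun g _ => ?_
    ring
  have hzero : ∀ g, ∑ π, c π * Y π g = 0 := fun g => by
    have := (sum_eq_zero_iff_of_nonneg fun g _ => sq_nonneg _).1 hsq g (mem_univ g)
    exact pow_eq_zero_iff (two_ne_zero) |>.1 this
  by_contra! hne
  obtain ⟨π₀, hπ₀⟩ := hne
  obtain ⟨τ, hτ⟩ := (Set.toFinite {π : SetPartition n | c π ≠ 0}).exists_maximal ⟨π₀, hπ₀⟩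
  obtain ⟨g, hg, hg'⟩ := exists_perm_cycles τ
  have := hzero g
  rw [sum_eq_single τ] at this
  · simp [Y, hg] at this
    exact hτ.1 this
  · intro σ _ hσ
    by_cases hs : ∀ x, σ.part (g x) = σ.part x
    · by_cases hcs : c σ = 0
      · simp [hcs]
      · exact absurd (le_antisymm (hτ.2 hcs (hg' σ hs)) (hg' σ hs)) hσ
    · simp [Y, hs]
  · simp

/-- A word of length `n` that occurs in `m_π`. -/
def word (π : SetPartition n) : Fin n → ℕ := fun j => Encodable.encode (π.part j)

theorem word_eq_iff (π : SetPartition n) (j k : Fin n) :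
    word π j = word π k ↔ π.part j = π.part k :=
  Encodable.encode_injective.eq_iff

theorem m_apply_word (σ π : SetPartition n) :
    (m σ : NCSeries).coeff (List.ofFn (word π)) = if σ = π then 1 else 0 := by
  classical
  refine (tupleSeries_ofFn _ _).trans (if_congr ?_ rfl rfl)
  simp only [word_eq_iff]
  refine ⟨fun H => setPartition_ext fun x y => (H x y).symm, ?_⟩
  rintro rfl x y
  rfl

theorem h_apply_word (π σ : SetPartition n) :
    (h π : NCSeries).coeff (List.ofFn (word σ)) = blockFactorial (σ ⊓ π) := by
  simp [h, NCSeries.coeff_sum, m_apply_word]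

theorem h_apply_of_length_ne (π : SetPartition n) {w : List ℕ} (hw : w.length ≠ n) :
    (h π : NCSeries).coeff w = 0 := by
  have hm : ∀ σ : SetPartition n, (m σ : NCSeries).coeff w = 0 := fun σ => tupleSeries_of_length_ne _ hw
  simp [h, NCSeries.coeff_sum, hm]

theorem linearIndependent_h :
    LinearIndependent ℚ fun π : Σ n, SetPartition n => h π.2 := by
  classical
  rw [linearIndependent_iff']
  intro s c hc
  suffices H : ∀ n, ∀ π : SetPartition n, (if (⟨n, π⟩ : Σ n, SetPartition n) ∈ s
      then c ⟨n, π⟩ else 0) = 0 by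
    rintro ⟨n, π⟩ hπ
    simpa [hπ] using H n π
  intro n
  refine Fintype.linearIndependent_iff.1 (linearIndependent_coeff (n := n)) _ ?_
  funext σ
  have h1 : (∑ π ∈ s, c π • (h π.2 : NCSeries)).coeff (List.ofFn (word σ)) = 0 := by
    have := congrArg (fun f : NCSym => (f : NCSeries).coeff (List.ofFn (word σ))) hc
    simpa using this
  rw [NCSeries.coeff_sum] at h1
  rw [Finset.sum_apply, Pi.zero_apply]
  refine Eq.trans ?_ h1
  have h2 : ∀ π ∈ s, π ∉ s.filter (fun π => π.1 = n) →
      (c π • (h π.2 : NCSeries)).coeff (List.ofFn (word σ)) = 0 := by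
    intro π hπ hπ'
    rw [NCSeries.coeff_smul, h_apply_of_length_ne, mul_zero]
    rw [List.length_ofFn]
    intro hn
    exact hπ' (mem_filter.2 ⟨hπ, hn.symm⟩)
  rw [← sum_subset (filter_subset _ s) h2]
  rw [← sum_filter_add_sum_filter_not univ
    (fun π : SetPartition n => (⟨n, π⟩ : Σ n, SetPartition n) ∈ s)]
  rw [add_eq_left.2]
  · refine sum_bij (fun π _ => (⟨n, π⟩ : Σ n, SetPartition n)) ?_ ?_ ?_ ?_
    · intro π hπ
      simpa using hπ
    · intro π _ π' _ hh
      simpa using hh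
    · rintro ⟨k, π⟩ hπ
      obtain ⟨hs, rfl⟩ := mem_filter.1 hπ
      exact ⟨π, by simpa using hs, rfl⟩
    · intro π hπ
      simp only [mem_filter, mem_univ, true_and] at hπ
      simp [hπ, h_apply_word]
  · refine sum_eq_zero fun π hπ => ?_
    simp only [mem_filter, mem_univ, true_and] at hπ
    simp [hπ]

theorem m_mem_span_h (σ : SetPartition n) :
    m σ ∈ Submodule.span ℚ (Set.range fun π : SetPartition n => h π) := by
  classical
  have hspan := (linearIndependent_coeff (n := n)).span_eq_top_of_card_eq_finrank (by simp)
  let Φ : (SetPartition n → ℚ) →ₗ[ℚ] NCSym := Fintype.linearCombination ℚ m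
  have hΦ : ∀ π : SetPartition n, Φ (fun σ => (blockFactorial (σ ⊓ π) : ℚ)) = h π := fun π => rfl
  have hm : m σ = Φ (Pi.single σ 1) := by simp [Φ]
  have hmem : (Pi.single σ 1 : SetPartition n → ℚ) ∈ Submodule.span ℚ (Set.range
      fun π : SetPartition n => (fun σ : SetPartition n => (blockFactorial (σ ⊓ π) : ℚ))) := by
    rw [hspan]
    trivial
  rw [hm]
  have := Submodule.mem_map_of_mem (f := Φ) hmem
  rw [Submodule.map_span, ← Set.range_comp] at this
  exact this

/-- The partition of `[n]` into the level sets of a tuple. -/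
theorem exists_setPartition (i : Fin n → ℕ) :
    ∃ π : SetPartition n, ∀ j k, i j = i k ↔ π.part j = π.part k := by
  classical
  refine ⟨Finpartition.ofSetoid (Setoid.ker i), fun j k => ?_⟩
  rw [part_eq_iff, Finpartition.mem_part_ofSetoid_iff_rel, eq_comm]
  rfl

theorem apply_eq_of_ker_eq (f : NCSym) (i i' : Fin n → ℕ)
    (hi : ∀ j k, i j = i k ↔ i' j = i' k) :
    (f : NCSeries).coeff (List.ofFn i) = (f : NCSeries).coeff (List.ofFn i') := by
  let φ : Set.range i → ℕ := fun x => i' x.2.choose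
  have hφ : ∀ j, φ ⟨i j, j, rfl⟩ = i' j := fun j => by
    have hx : ∃ k, i k = i j := ⟨j, rfl⟩
    exact (hi _ _).1 hx.choose_spec
  have hinj : Function.Injective φ := by
    rintro ⟨_, j, rfl⟩ ⟨_, k, rfl⟩ hjk
    rw [hφ, hφ, ← hi] at hjk
    exact Subtype.ext hjk
  obtain ⟨τ, hτ⟩ := Perm.exists_extending_pair (Subtype.val : Set.range i → ℕ) φ
    Subtype.val_injective hinj
  have : List.ofFn i' = (List.ofFn i).map τ := by
    rw [List.map_ofFn]
    congr 1
    funext j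
    rw [← hφ j, ← hτ]
    rfl
  rw [this, f.2.2]

theorem span_h : ⊤ ≤ Submodule.span ℚ (Set.range fun π : Σ n, SetPartition n => h π.2) := by
  classical
  have hm : ∀ n (σ : SetPartition n),
      m σ ∈ Submodule.span ℚ (Set.range fun π : Σ n, SetPartition n => h π.2) := fun n σ => by
    refine Submodule.span_mono ?_ (m_mem_span_h σ)
    rintro _ ⟨π, rfl⟩
    exact ⟨⟨n, π⟩, rfl⟩
  rintro f -
  obtain ⟨N, hN⟩ := f.2.1
  have hf : f = ∑ n ∈ range (N + 1), ∑ σ : SetPartition n,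
      ((f : NCSeries).coeff (List.ofFn (word σ))) • m σ := by
    refine Subtype.ext (NCSeries.ext_coeff fun w => ?_)
    obtain ⟨k, i, rfl⟩ : ∃ k, ∃ i : Fin k → ℕ, w = List.ofFn i :=
      ⟨_, w.get, (List.ofFn_get w).symm⟩
    obtain ⟨π, hπ⟩ := exists_setPartition i
    have hfw : (f : NCSeries).coeff (List.ofFn i) = (f : NCSeries).coeff (List.ofFn (word π)) :=
      apply_eq_of_ker_eq f _ _ fun j k => by rw [hπ, word_eq_iff]
    have hmw : ∀ σ : SetPartition k, (m σ : NCSeries).coeff (List.ofFn i) = if σ = π then 1 else 0 :=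
      fun σ => by
        rw [← m_apply_word]
        exact apply_eq_of_ker_eq (m σ) _ _ fun j k => by rw [hπ, word_eq_iff]
    have hoff : ∀ l, l ≠ k → ∑ σ : SetPartition l,
        (f : NCSeries).coeff (List.ofFn (word σ)) * (m σ : NCSeries).coeff (List.ofFn i) = 0 := by
      intro l hl
      refine sum_eq_zero fun σ _ => ?_
      rw [show (m σ : NCSeries).coeff (List.ofFn i) = 0 from
        tupleSeries_of_length_ne _ (by simpa using hl.symm), mul_zero]
    have hR : ((∑ n ∈ range (N + 1), ∑ σ : SetPartition n,
        ((f : NCSeries).coeff (List.ofFn (word σ))) • m σ : NCSym) : NCSeries).coeff (List.ofFn i) =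
        ∑ n ∈ range (N + 1), ∑ σ : SetPartition n,
        (f : NCSeries).coeff (List.ofFn (word σ)) * (m σ : NCSeries).coeff (List.ofFn i) := by
      simp [NCSeries.coeff_sum]
    rw [hR]
    by_cases hk : k < N + 1
    · rw [sum_eq_single k (fun l _ hl => hoff l hl) (fun hk' => absurd (mem_range.2 hk) hk')]
      simp [hmw, hfw]
    · rw [sum_eq_zero fun l hl => hoff l (by rw [mem_range] at hl; omega)]
      exact hN _ (by rw [List.length_ofFn]; omega)
  rw [hf]
  exact Submodule.sum_mem _ fun n _ => Submodule.sum_mem _ fun σ _ =>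
    Submodule.smul_mem _ _ (hm n σ)

/-- The basis `{h_π}` of `NCSym`, indexed by all set partitions `π` of `[n]`, `n ≥ 0`. -/
def hBasis : Module.Basis (Σ n, SetPartition n) ℚ NCSym :=
  Module.Basis.mk linearIndependent_h span_h

theorem hBasis_apply (π : Σ n, SetPartition n) : hBasis π = h π.2 :=
  Module.Basis.mk_apply _ _ _

/-! ### The maps `ω`, `ρ` and the action of permutations -/

/-- The linear map `ω` on `NCSym` with `ω(h_π) = e_π` for all set partitions `π`. -/
def omega : NCSym →ₗ[ℚ] NCSym := hBasis.constr ℚ fun π => e π.2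

theorem omega_h (π : SetPartition n) : omega (h π) = e π := by
  have := hBasis.constr_basis ℚ (fun π : Σ n, SetPartition n => e π.2) ⟨n, π⟩
  rwa [hBasis_apply] at this

/-- The word `w` of length `n` with its letters rearranged: position `j` gets the letter that `w`
has in position `δ j`. Words of other lengths are unchanged. -/
def permuteWord (δ : Perm (Fin n)) (w : List ℕ) : List ℕ :=
  if hw : w.length = n then List.ofFn fun j : Fin n => w.get (Fin.cast hw.symm (δ j)) else w

theorem permuteWord_ofFn (δ : Perm (Fin n)) (i : Fin n → ℕ) :
    permuteWord δ (List.ofFn i) = List.ofFn (i ∘ δ) := by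
  unfold permuteWord
  rw [dif_pos (List.length_ofFn)]
  congr 1
  funext j
  simp

theorem permuteWord_of_length_ne (δ : Perm (Fin n)) {w : List ℕ} (hw : w.length ≠ n) :
    permuteWord δ w = w :=
  dif_neg hw

theorem length_permuteWord (δ : Perm (Fin n)) (w : List ℕ) :
    (permuteWord δ w).length = w.length := by
  unfold permuteWord
  split_ifs with hw
  · simp [hw]
  · rfl

theorem permuteWord_map (δ : Perm (Fin n)) (τ : ℕ → ℕ) (w : List ℕ) :
    permuteWord δ (w.map τ) = (permuteWord δ w).map τ := by
  unfold permuteWord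
  split_ifs with h1 h2 h2
  · rw [List.map_ofFn]
    congr 1
    funext j
    simp
  · simp at h1
    exact absurd h1 h2
  · simp at h1
    exact absurd h2 h1
  · rfl

/-- The action of `δ ∈ 𝔖ₙ` on `NCSym`. On the homogeneous functions of degree `n` it permutes the
places of the letters, so that `δ ∘ m_π = m_{δπ}` for set partitions `π` of `[n]`;
on the other degrees, where it is not used, it is the identity. -/
def permute (δ : Perm (Fin n)) : NCSym →ₗ[ℚ] NCSym where
  toFun f := ⟨⟨fun w => (f : NCSeries).coeff (permuteWord δ w)⟩, by
    obtain ⟨N, hN⟩ := f.2.1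
    refine ⟨⟨N, fun w hw => hN _ (by rwa [length_permuteWord])⟩, fun τ w => ?_⟩
    change (f : NCSeries).coeff _ = (f : NCSeries).coeff _
    rw [permuteWord_map, f.2.2]⟩
  map_add' _ _ := rfl
  map_smul' _ _ := rfl

/-- The image `δπ` of a set partition `π` under `δ`: its blocks are the `δ(B)`, `B` a block
of `π`. -/
def permutePartition (δ : Perm (Fin n)) (π : SetPartition n) : SetPartition n := by
  classical
  exact Finpartition.ofSetoid (Setoid.ker fun x => π.part (δ.symm x))

theorem part_permutePartition (δ : Perm (Fin n)) (π : SetPartition n) (x : Fin n) :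
    (permutePartition δ π).part x = (π.part (δ.symm x)).map δ.toEmbedding := by
  classical
  ext y
  unfold permutePartition
  rw [Finpartition.mem_part_ofSetoid_iff_rel, mem_map_equiv, ← part_eq_iff]
  exact eq_comm

theorem permute_m (δ : Perm (Fin n)) (π : SetPartition n) :
    permute δ (m π) = m (permutePartition δ π) := by
  classical
  refine Subtype.ext (NCSeries.ext_coeff fun w => ?_)
  change (m π : NCSeries).coeff (permuteWord δ w) = _
  by_cases hw : w.length = n
  · obtain ⟨i, rfl⟩ : ∃ i : Fin n → ℕ, w = List.ofFn i := by
      subst hw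
      exact ⟨w.get, (List.ofFn_get w).symm⟩
    rw [permuteWord_ofFn]
    refine (tupleSeries_ofFn _ _).trans (Eq.trans (if_congr ?_ rfl rfl)
      (tupleSeries_ofFn _ _).symm)
    simp only [part_permutePartition, (map_injective _).eq_iff]
    constructor
    · intro H j k
      simpa using H (δ.symm j) (δ.symm k)
    · intro H j k
      simpa using H (δ j) (δ k)
  · rw [permuteWord_of_length_ne δ hw]
    exact (tupleSeries_of_length_ne _ hw).trans (tupleSeries_of_length_ne _ hw).symm

/-- The projection `ρ : ℚ⟨⟨x₀, x₁, …⟩⟩ → ℚ[[x₀, x₁, …]]` that lets the variables commute: the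
coefficient of a monomial is the sum of the coefficients of all words with this content. -/
def rho : NCSeries →ₗ[ℚ] MvPowerSeries ℕ ℚ where
  toFun f := fun d => ∑ w ∈ (Finsupp.toMultiset d).lists.toFinset, f.coeff w
  map_add' f g := by
    funext d
    exact sum_add_distrib
  map_smul' c f := by
    funext d
    exact (mul_sum _ _ _).symm

theorem mem_words_iff (d : ℕ →₀ ℕ) (w : List ℕ) :
    w ∈ (Finsupp.toMultiset d).lists.toFinset ↔ ∀ i, w.count i = d i := by
  rw [Multiset.mem_toFinset, Multiset.mem_lists_iff]
  change Finsupp.toMultiset d = (w : Multiset ℕ) ↔ _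
  rw [Multiset.ext]
  simp [Finsupp.count_toMultiset, eq_comm]

/-! ### Shapes, reading permutations and Schur functions -/

/-- The block sizes of `π` in weakly decreasing order. -/
def blockSizes (π : SetPartition n) : List ℕ := (π.parts.val.map card).sort (· ≥ ·)

theorem blockSizes_sortedGE (π : SetPartition n) : (blockSizes π).SortedGE :=
  (Multiset.pairwise_sort _ _).sortedGE

/-- The integer partition `λ(π)`, as a Young diagram. Its parts `λ₁ ≥ λ₂ ≥ ⋯` (indexed from `0`)
are given by `rowLen`, and their number is `colLen 0`. -/
def shape (π : SetPartition n) : YoungDiagram :=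
  YoungDiagram.ofRowLens (blockSizes π) (blockSizes_sortedGE π)

/-- The permutation `δ_π`. In one-line notation, it lists the blocks of `π` by weakly
decreasing size, blocks of the same size by increasing least element, and the
elements of each block in increasing order. (`Tuple.sort` breaks ties by the natural order
of `Fin n`.) -/
def readingPerm (π : SetPartition n) : Perm (Fin n) :=
  Tuple.sort fun x : Fin n =>
    (toLex (OrderDual.toDual (π.part x).card, (π.part x).min) : ℕᵒᵈ ×ₗ WithTop (Fin n))

/-- The noncommutative Leibniz determinant, with products taken from the top row to the
bottom row. -/
def ncdet {R : Type*} [Ring R] {k : ℕ} (A : Matrix (Fin k) (Fin k) R) : R :=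
  ∑ ε : Perm (Fin k), Perm.sign ε • (List.ofFn fun i => A i (ε i)).prod

/-- `(1/k!) h_{[k]}`, which is `0` for negative `k`. -/
def hEntry (k : ℤ) : NCSym :=
  if 0 ≤ k then (1 / (k.toNat.factorial : ℚ)) • h (⊤ : SetPartition k.toNat) else 0

/-- `(1/k!) e_{[k]}`, which is `0` for negative `k`. -/
def eEntry (k : ℤ) : NCSym :=
  if 0 ≤ k then (1 / (k.toNat.factorial : ℚ)) • e (⊤ : SetPartition k.toNat) else 0

/-- The source Schur function `s_{[μ]}`. -/
def sourceSchur (μ : YoungDiagram) : NCSym :=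
  ncdet (Matrix.of fun i j : Fin (μ.colLen 0) => hEntry ((μ.rowLen i : ℤ) - i + j))

/-- The standard Schur function in noncommuting variables `s_π = δ_π ∘ s_{[λ(π)]}`. -/
def schur (π : SetPartition n) : NCSym := permute (readingPerm π) (sourceSchur (shape π))

/-- The transposed standard Schur function in noncommuting variables `s^t_π = ω(s_π)`. -/
def schurTranspose (π : SetPartition n) : NCSym := omega (schur π)

end NCSym

/-- The complete homogeneous symmetric function `h_k` in the commuting variables `x₀, x₁, …`:
the sum of all monomials of degree `k`. It is `0` for negative `k`. -/
def symH (k : ℤ) : MvPowerSeries ℕ ℚ := fun d => if (d.degree : ℤ) = k then 1 else 0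

/-- The Schur function `s_μ = det(h_{μ_i - i + j})`. -/
def symSchur (μ : YoungDiagram) : MvPowerSeries ℕ ℚ :=
  Matrix.det (Matrix.of fun i j : Fin (μ.colLen 0) => symH ((μ.rowLen i : ℤ) - i + j))

end

/-!
The argument is carried by words. A word `u` of colours gives the set partition of its places into
places of equal colour, and `hWord u`, `eWord u` are the functions `h` and `e` of this partition.
The coefficients of both at a word `w` depend only on the multiset of pairs (colour, letter): it is
the product of the factorials of the multiplicities for `h`, and the indicator that no pair repeats
for `e`. Hence both are multiplicative on concatenations of words in disjoint sets of colours
(`hWord_append`, `eWord_append`) and equivariant for place permutations (`permute_h`, `permute_e`).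
So `ω` commutes with products of the `h_[k]` and with place permutations, which gives the
determinantal formula for `s^t_π` (`schurTranspose_eq`).

*Basis.* The `e_π` of one degree are independent: the indicator of `σ ⊓ π = ⊥` is the sum of
`sgn g` over the permutations `g` whose orbits refine both `σ` and `π`, and since `sgn g` depends only
on the orbits of `g`, this factors the matrix of the `e_π` into triangular matrices with
nonzero diagonals (`linearIndependent_e_coeff`). In the expansion of the determinant, the identity
contributes a nonzero multiple of `e_π`, by the choice of `δ_π`, and every other permutation
a multiple of some `e_σ` with a larger sum of squares of block sizes, by the rearrangement inequality
(`schurTranspose_triangular`). Independence in each degree suffices by counting dimensions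
(`basis_of_homogeneous`).

*Commuting variables.* The map `ρ` is multiplicative, ignores place permutations, and sends
`e_[k] / k!` to the elementary symmetric function `e_k`, so that `ρ(s^t_π) = det(e_{λ_i - i + j})`.
This is the Schur function of the transposed shape by the dual Jacobi–Trudi identity
(`dual_jacobiTrudi`): the two determinants are complementary minors of inverse Toeplitz
matrices, and the sign of the permutation that relates their index sets is
`(-1)^|λ|`, as its inversions are the cells of the diagram.
-/

noncomputable section

namespace NCSym

/-! ### Colour words -/

section Words

variable {n : ℕ} {α : Type*}

/-- The set partition of `[n]` into the level sets of a function on `[n]`. -/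
def kerPartition (c : Fin n → α) : SetPartition n := by
  classical
  exact Finpartition.ofSetoid (Setoid.ker c)

theorem part_kerPartition_eq_iff (c : Fin n → α) (x y : Fin n) :
    (kerPartition c).part x = (kerPartition c).part y ↔ c x = c y := by
  classical
  rw [part_eq_iff, kerPartition, Finpartition.mem_part_ofSetoid_iff_rel, eq_comm]
  rfl

theorem kerPartition_eq_iff (c : Fin n → α) (π : SetPartition n) :
    kerPartition c = π ↔ ∀ x y, c x = c y ↔ π.part x = π.part y := by
  refine ⟨?_, fun H => setPartition_ext fun x y => ?_⟩
  · rintro rfl x y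
    rw [part_kerPartition_eq_iff]
  · rw [part_kerPartition_eq_iff, H]

theorem kerPartition_part (π : SetPartition n) : kerPartition π.part = π :=
  (kerPartition_eq_iff _ _).2 fun _ _ => Iff.rfl

theorem kerPartition_const (k : ℕ) (a : α) : kerPartition (fun _ : Fin k => a) = ⊤ :=
  le_antisymm le_top ((le_iff_part _ _).2 fun x y _ => by rw [part_kerPartition_eq_iff])

theorem permutePartition_kerPartition (δ : Perm (Fin n)) (c : Fin n → α) :
    permutePartition δ (kerPartition c) = kerPartition (c ∘ δ.symm) := by
  refine ((kerPartition_eq_iff _ _).2 fun x y => ?_).symm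
  rw [part_permutePartition, part_permutePartition, (map_injective _).eq_iff,
    part_kerPartition_eq_iff]
  rfl

/-- The product of the factorials of the multiplicities of the entries of a list. -/
def multFactorial [DecidableEq α] (l : List α) : ℕ := ∏ a ∈ l.toFinset, (l.count a).factorial

theorem multFactorial_perm [DecidableEq α] {l l' : List α} (hl : l.Perm l') :
    multFactorial l = multFactorial l' := by
  unfold multFactorial
  rw [List.toFinset_eq_of_perm _ _ hl]
  exact prod_congr rfl fun a _ => by rw [hl.count_eq]

theorem multFactorial_append [DecidableEq α] {l l' : List α} (hl : l.Disjoint l') :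
    multFactorial (l ++ l') = multFactorial l * multFactorial l' := by
  unfold multFactorial
  rw [List.toFinset_append, prod_union (List.disjoint_toFinset_iff_disjoint.2 hl)]
  congr 1
  · refine prod_congr rfl fun a ha => ?_
    rw [List.count_append, List.count_eq_zero.2 (hl (List.mem_toFinset.1 ha)), add_zero]
  · refine prod_congr rfl fun a ha => ?_
    rw [List.count_append, List.count_eq_zero.2 fun h' => hl h' (List.mem_toFinset.1 ha), zero_add]

theorem count_ofFn [BEq α] [LawfulBEq α] [DecidableEq α] (c : Fin n → α) (a : α) :
    (List.ofFn c).count a = (univ.filter fun x => c x = a).card := by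
  rw [List.ofFn_eq_map, List.count, List.countP_map, List.countP_eq_length_filter]
  rw [← List.toFinset_card_of_nodup ((List.nodup_finRange n).filter _)]
  congr 1
  ext x
  simp

theorem parts_kerPartition [DecidableEq α] (c : Fin n → α) :
    (kerPartition c).parts = (univ.image c).image fun a => univ.filter fun x => c x = a := by
  classical
  have hpart : ∀ y, (kerPartition c).part y = univ.filter fun x => c x = c y := fun y => by
    ext x
    simp [← part_eq_iff, part_kerPartition_eq_iff]
  ext B
  simp only [mem_image, mem_univ, true_and, exists_exists_eq_and, ← hpart]
  constructor
  · intro hB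
    obtain ⟨x, hx⟩ := (kerPartition c).nonempty_of_mem_parts hB
    exact ⟨x, (kerPartition c).part_eq_of_mem hB hx⟩
  · rintro ⟨x, rfl⟩
    exact (kerPartition c).part_mem.2 (mem_univ x)

theorem filter_eq_injOn_image [DecidableEq α] (c : Fin n → α) :
    Set.InjOn (fun a => univ.filter fun x => c x = a) (univ.image c : Finset α) := by
  intro a ha b _ hab
  obtain ⟨x, -, rfl⟩ := mem_image.1 (mem_coe.1 ha)
  have : x ∈ univ.filter fun y => c y = b := by
    rw [← show _ = univ.filter fun y => c y = b from hab]
    simp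
  simpa using this

theorem blockFactorial_kerPartition [DecidableEq α] (c : Fin n → α) :
    blockFactorial (kerPartition c) = multFactorial (List.ofFn c) := by
  classical
  unfold blockFactorial multFactorial
  rw [parts_kerPartition, prod_image (filter_eq_injOn_image c)]
  refine prod_congr ?_ fun a _ => by rw [count_ofFn]
  ext a
  simp

/-- The coefficient of `h_π` at a word `i`, where `π` is given by a colouring `c`: it only depends on
the word of pairs (colour, letter). -/
theorem coeff_h_kerPartition [DecidableEq α] (c : Fin n → α) (i : Fin n → ℕ) :
    (h (kerPartition c) : NCSeries).coeff (List.ofFn i) =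
      multFactorial (List.ofFn fun x => (c x, i x)) := by
  have h1 := apply_eq_of_ker_eq (h (kerPartition c)) i (word (kerPartition i)) fun j k => by
    rw [word_eq_iff, part_kerPartition_eq_iff]
  rw [h1, h_apply_word, ← blockFactorial_kerPartition]
  congr 2
  refine ((kerPartition_eq_iff _ _).2 fun x y => ?_).symm
  rw [part_inf_eq_iff, part_kerPartition_eq_iff, part_kerPartition_eq_iff, Prod.mk.injEq, and_comm]

theorem coeff_e_kerPartition (c : Fin n → α) (i : Fin n → ℕ)
    [Decidable (List.ofFn fun x => (c x, i x)).Nodup] :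
    (e (kerPartition c) : NCSeries).coeff (List.ofFn i) =
      if (List.ofFn fun x => (c x, i x)).Nodup then 1 else 0 := by
  classical
  refine (tupleSeries_ofFn _ _).trans (if_congr ?_ rfl rfl)
  rw [List.nodup_ofFn]
  simp only [part_kerPartition_eq_iff]
  constructor
  · intro H x y hxy
    rw [Prod.mk.injEq] at hxy
    by_contra hne
    exact H x y hne hxy.1 hxy.2
  · intro H x y hne hc hi
    exact hne (H (Prod.ext hc hi))

theorem e_apply_of_length_ne (π : SetPartition n) {w : List ℕ} (hw : w.length ≠ n) :
    (e π : NCSeries).coeff w = 0 :=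
  tupleSeries_of_length_ne _ hw

/-- The series whose coefficient at a word `w` is a weight of the word of pairs
(colour, letter), where `u` lists the colours of the places. -/
def wordSeries (φ : List (α × ℕ) → ℚ) (u : List α) : NCSeries :=
  ⟨fun w => if w.length = u.length then φ (u.zip w) else 0⟩

theorem exists_eq_ofFn {u : List α} (hu : u.length = n) : ∃ c : Fin n → α, u = List.ofFn c := by
  subst hu
  exact ⟨u.get, (List.ofFn_get u).symm⟩

theorem zip_ofFn (c : Fin n → α) (i : Fin n → ℕ) :
    (List.ofFn c).zip (List.ofFn i) = List.ofFn fun x => (c x, i x) :=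
  List.ext_get (by simp) (by simp)

theorem eq_wordSeries {f : NCSeries} {φ : List (α × ℕ) → ℚ} (c : Fin n → α)
    (hf : ∀ w : List ℕ, w.length ≠ n → f.coeff w = 0)
    (hφ : ∀ i : Fin n → ℕ, f.coeff (List.ofFn i) = φ (List.ofFn fun x => (c x, i x))) :
    f = wordSeries φ (List.ofFn c) := by
  refine NCSeries.ext_coeff fun w => ?_
  by_cases hw : w.length = n
  · obtain ⟨i, rfl⟩ := exists_eq_ofFn hw
    simp only [wordSeries]
    rw [hφ, if_pos (by simp), zip_ofFn]
  · simp only [wordSeries]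
    rw [hf w hw, if_neg (by simpa using hw)]

theorem coeff_mul_of_homogeneous {f g : NCSeries} {a : ℕ}
    (hf : ∀ w : List ℕ, w.length ≠ a → f.coeff w = 0) (w : List ℕ) :
    (f * g).coeff w = f.coeff (w.take a) * g.coeff (w.drop a) := by
  rw [NCSeries.coeff_mul]
  by_cases ha : a ≤ w.length
  · refine sum_eq_single a (fun k hk hka => ?_) fun hk => ?_
    · rw [hf _ (by rw [List.length_take]; rw [mem_range] at hk; omega), zero_mul]
    · rw [mem_range] at hk
      omega
  · rw [hf (w.take a) (by rw [List.length_take]; omega), zero_mul]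
    refine sum_eq_zero fun k hk => ?_
    rw [hf _ (by rw [List.length_take]; omega), zero_mul]

/-- A weight that is multiplicative over disjoint words of pairs gives series that are
multiplicative over words in disjoint sets of colours. -/
theorem wordSeries_append {φ : List (α × ℕ) → ℚ}
    (hφ : ∀ l l' : List (α × ℕ), l.Disjoint l' → φ (l ++ l') = φ l * φ l')
    {u v : List α} (huv : u.Disjoint v) :
    wordSeries φ (u ++ v) = wordSeries φ u * wordSeries φ v := by
  refine NCSeries.ext_coeff fun w => ?_
  rw [coeff_mul_of_homogeneous (a := u.length) fun w hw => if_neg hw]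
  by_cases hw : w.length = u.length + v.length
  · have h1 : (w.take u.length).length = u.length := by rw [List.length_take]; omega
    have h2 : (w.drop u.length).length = v.length := by rw [List.length_drop]; omega
    simp only [wordSeries]
    rw [if_pos (by simpa using hw), if_pos h1, if_pos h2, ← hφ, ← List.zip_append h1.symm,
      List.take_append_drop]
    rintro ⟨a, b⟩ h3 h4
    exact huv (List.of_mem_zip h3).1 (List.of_mem_zip h4).1
  · simp only [wordSeries]
    rw [if_neg (by simpa using hw)]
    by_cases h1 : (w.take u.length).length = u.length
    · have h2 : (w.drop u.length).length ≠ v.length := by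
        rw [List.length_take] at h1
        rw [List.length_drop]
        omega
      rw [if_neg h2, mul_zero]
    · rw [if_neg h1, zero_mul]

/-- The function `h_π` for the partition `π` of the places of a word into places of equal
colour. -/
def hWord (u : List α) : NCSym := h (kerPartition u.get)

/-- The function `e_π` for the partition `π` of the places of a word into places of equal
colour. -/
def eWord (u : List α) : NCSym := e (kerPartition u.get)

theorem coe_h_kerPartition [DecidableEq α] (c : Fin n → α) :
    (h (kerPartition c) : NCSeries) = wordSeries (fun l => (multFactorial l : ℚ)) (List.ofFn c) :=
  eq_wordSeries c (fun _ hw => h_apply_of_length_ne _ hw) fun i => coeff_h_kerPartition c i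

theorem coe_e_kerPartition [DecidableEq α] (c : Fin n → α) :
    (e (kerPartition c) : NCSeries) =
      wordSeries (fun l => if l.Nodup then 1 else 0) (List.ofFn c) :=
  eq_wordSeries c (fun _ hw => e_apply_of_length_ne _ hw) fun i => coeff_e_kerPartition c i

theorem coe_hWord [DecidableEq α] (u : List α) :
    (hWord u : NCSeries) = wordSeries (fun l => (multFactorial l : ℚ)) u := by
  rw [hWord, coe_h_kerPartition, List.ofFn_get]

theorem coe_eWord [DecidableEq α] (u : List α) :
    (eWord u : NCSeries) = wordSeries (fun l => if l.Nodup then 1 else 0) u := by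
  rw [eWord, coe_e_kerPartition, List.ofFn_get]

theorem hWord_ofFn (c : Fin n → α) : hWord (List.ofFn c) = h (kerPartition c) := by
  classical
  exact Subtype.ext (by rw [coe_hWord, coe_h_kerPartition])

theorem eWord_ofFn (c : Fin n → α) : eWord (List.ofFn c) = e (kerPartition c) := by
  classical
  exact Subtype.ext (by rw [coe_eWord, coe_e_kerPartition])

theorem hWord_append {u v : List α} (huv : u.Disjoint v) : hWord (u ++ v) = hWord u * hWord v := by
  classical
  refine Subtype.ext ?_
  rw [Subalgebra.coe_mul, coe_hWord, coe_hWord, coe_hWord]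
  exact wordSeries_append (fun l l' hl => by rw [multFactorial_append hl, Nat.cast_mul]) huv

theorem eWord_append {u v : List α} (huv : u.Disjoint v) : eWord (u ++ v) = eWord u * eWord v := by
  classical
  refine Subtype.ext ?_
  rw [Subalgebra.coe_mul, coe_eWord, coe_eWord, coe_eWord]
  refine wordSeries_append (fun l l' hl => ?_) huv
  simp only [List.nodup_append', hl, and_true]
  split_ifs <;> simp_all

theorem hWord_nil : hWord ([] : List α) = 1 := by
  classical
  refine Subtype.ext (NCSeries.ext_coeff fun w => ?_)
  rw [coe_hWord, Subalgebra.coe_one, NCSeries.coeff_one]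
  simp [wordSeries, multFactorial]

theorem eWord_nil : eWord ([] : List α) = 1 := by
  classical
  refine Subtype.ext (NCSeries.ext_coeff fun w => ?_)
  rw [coe_eWord, Subalgebra.coe_one, NCSeries.coeff_one]
  simp [wordSeries]

theorem hWord_replicate (k : ℕ) (a : α) : hWord (List.replicate k a) = h (⊤ : SetPartition k) := by
  rw [← List.ofFn_const, hWord_ofFn, kerPartition_const]

theorem eWord_replicate (k : ℕ) (a : α) : eWord (List.replicate k a) = e (⊤ : SetPartition k) := by
  rw [← List.ofFn_const, eWord_ofFn, kerPartition_const]

theorem disjoint_replicate_flatMap {v : α} {vs : List α} (hv : v ∉ vs) (k : α → ℕ) :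
    (List.replicate (k v) v).Disjoint (vs.flatMap fun v => List.replicate (k v) v) := by
  intro a ha ha'
  obtain ⟨b, hb, hab⟩ := List.mem_flatMap.1 ha'
  obtain rfl := List.eq_of_mem_replicate ha
  obtain rfl := List.eq_of_mem_replicate hab
  exact hv hb

theorem prod_h_top {vs : List α} (hvs : vs.Nodup) (k : α → ℕ) :
    (vs.map fun v => h (⊤ : SetPartition (k v))).prod =
      hWord (vs.flatMap fun v => List.replicate (k v) v) := by
  induction vs with
  | nil => simp [hWord_nil]
  | cons v vs ih =>
    rw [List.nodup_cons] at hvs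
    rw [List.map_cons, List.prod_cons, ih hvs.2, List.flatMap_cons,
      hWord_append (disjoint_replicate_flatMap hvs.1 k), hWord_replicate]

theorem prod_e_top {vs : List α} (hvs : vs.Nodup) (k : α → ℕ) :
    (vs.map fun v => e (⊤ : SetPartition (k v))).prod =
      eWord (vs.flatMap fun v => List.replicate (k v) v) := by
  induction vs with
  | nil => simp [eWord_nil]
  | cons v vs ih =>
    rw [List.nodup_cons] at hvs
    rw [List.map_cons, List.prod_cons, ih hvs.2, List.flatMap_cons,
      eWord_append (disjoint_replicate_flatMap hvs.1 k), eWord_replicate]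

theorem omega_hWord (u : List α) : omega (hWord u) = eWord u := omega_h _

end Words

/-! ### The map `ω` commutes with place permutations and with determinants -/

section Omega

variable {n : ℕ}

theorem permute_h (δ : Perm (Fin n)) (π : SetPartition n) :
    permute δ (h π) = h (permutePartition δ π) := by
  classical
  refine Subtype.ext (NCSeries.ext_coeff fun w => ?_)
  change (h π : NCSeries).coeff (permuteWord δ w) = _
  by_cases hw : w.length = n
  · obtain ⟨i, rfl⟩ := exists_eq_ofFn hw
    rw [permuteWord_ofFn, ← kerPartition_part π, permutePartition_kerPartition,
      coeff_h_kerPartition, coeff_h_kerPartition]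
    congr 1
    refine multFactorial_perm ?_
    convert Equiv.Perm.ofFn_comp_perm δ (fun x => ((π.part ∘ δ.symm) x, i x)) using 2
    funext x
    simp
  · rw [permuteWord_of_length_ne δ hw, h_apply_of_length_ne _ hw, h_apply_of_length_ne _ hw]

theorem permute_e (δ : Perm (Fin n)) (π : SetPartition n) :
    permute δ (e π) = e (permutePartition δ π) := by
  classical
  refine Subtype.ext (NCSeries.ext_coeff fun w => ?_)
  change (e π : NCSeries).coeff (permuteWord δ w) = _
  by_cases hw : w.length = n
  · obtain ⟨i, rfl⟩ := exists_eq_ofFn hw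
    rw [permuteWord_ofFn, ← kerPartition_part π, permutePartition_kerPartition,
      coeff_e_kerPartition, coeff_e_kerPartition]
    refine if_congr (List.Perm.nodup_iff ?_) rfl rfl
    convert Equiv.Perm.ofFn_comp_perm δ (fun x => ((π.part ∘ δ.symm) x, i x)) using 2
    funext x
    simp
  · rw [permuteWord_of_length_ne δ hw, e_apply_of_length_ne _ hw, e_apply_of_length_ne _ hw]

theorem permute_of_homogeneous {k : ℕ} (hk : k ≠ n) (δ : Perm (Fin n)) (f : NCSym)
    (hf : ∀ w : List ℕ, w.length ≠ k → (f : NCSeries).coeff w = 0) : permute δ f = f := by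
  refine Subtype.ext (NCSeries.ext_coeff fun w => ?_)
  change (f : NCSeries).coeff (permuteWord δ w) = _
  by_cases hw : w.length = n
  · rw [hf w (by omega), hf _ (by rw [length_permuteWord]; omega)]
  · rw [permuteWord_of_length_ne δ hw]

theorem omega_permute (δ : Perm (Fin n)) (f : NCSym) :
    omega (permute δ f) = permute δ (omega f) := by
  suffices H : omega ∘ₗ permute δ = permute δ ∘ₗ omega from LinearMap.congr_fun H f
  refine hBasis.ext ?_
  rintro ⟨k, π⟩
  rw [hBasis_apply, LinearMap.comp_apply, LinearMap.comp_apply, omega_h]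
  by_cases hk : k = n
  · subst hk
    rw [permute_h, permute_e, omega_h]
  · rw [permute_of_homogeneous hk δ _ fun _ hw => h_apply_of_length_ne _ hw,
      permute_of_homogeneous hk δ _ fun _ hw => e_apply_of_length_ne _ hw, omega_h]

variable {l : ℕ}

theorem prod_map_smul {α : Type*} {A : Type*} [Ring A] [Algebra ℚ A] (vs : List α) (a : α → ℚ)
    (f : α → A) : (vs.map fun v => a v • f v).prod = (vs.map a).prod • (vs.map f).prod := by
  induction vs with
  | nil => simp
  | cons v vs ih => simp [ih, smul_smul, mul_comm]

/-- The word that has `k i` places of the colour `i`, the colours in increasing order. -/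
def segmentWord (k : Fin l → ℕ) : List (Fin l) :=
  (List.finRange l).flatMap fun i => List.replicate (k i) i

theorem prod_hEntry (k : Fin l → ℕ) :
    (List.ofFn fun i => hEntry (k i)).prod =
      (∏ i, (1 / (k i).factorial : ℚ)) • hWord (segmentWord k) := by
  simp only [hEntry, Nat.cast_nonneg, if_true, Int.toNat_natCast]
  rw [List.ofFn_eq_map, prod_map_smul, prod_h_top (List.nodup_finRange l), ← List.ofFn_eq_map,
    List.prod_ofFn, segmentWord]

theorem prod_eEntry (k : Fin l → ℕ) :
    (List.ofFn fun i => eEntry (k i)).prod =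
      (∏ i, (1 / (k i).factorial : ℚ)) • eWord (segmentWord k) := by
  simp only [eEntry, Nat.cast_nonneg, if_true, Int.toNat_natCast]
  rw [List.ofFn_eq_map, prod_map_smul, prod_e_top (List.nodup_finRange l), ← List.ofFn_eq_map,
    List.prod_ofFn, segmentWord]

theorem prod_hEntry_of_neg {z : Fin l → ℤ} {i : Fin l} (hi : z i < 0) :
    (List.ofFn fun i => hEntry (z i)).prod = 0 :=
  List.prod_eq_zero (List.mem_ofFn.2 ⟨i, if_neg hi.not_ge⟩)

theorem prod_eEntry_of_neg {z : Fin l → ℤ} {i : Fin l} (hi : z i < 0) :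
    (List.ofFn fun i => eEntry (z i)).prod = 0 :=
  List.prod_eq_zero (List.mem_ofFn.2 ⟨i, if_neg hi.not_ge⟩)

theorem omega_prod_hEntry (z : Fin l → ℤ) :
    omega (List.ofFn fun i => hEntry (z i)).prod = (List.ofFn fun i => eEntry (z i)).prod := by
  by_cases hz : ∀ i, 0 ≤ z i
  · lift z to Fin l → ℕ using hz
    rw [prod_hEntry, prod_eEntry, map_smul, omega_hWord]
  · push Not at hz
    obtain ⟨i, hi⟩ := hz
    rw [prod_hEntry_of_neg hi, prod_eEntry_of_neg hi, map_zero]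

theorem omega_ncdet (z : Fin l → Fin l → ℤ) :
    omega (ncdet (Matrix.of fun i j => hEntry (z i j))) =
      ncdet (Matrix.of fun i j => eEntry (z i j)) := by
  unfold ncdet
  rw [map_sum]
  refine sum_congr rfl fun ε _ => ?_
  rw [Units.smul_def, Units.smul_def, map_zsmul]
  congr 1
  exact omega_prod_hEntry fun i => z i (ε i)

/-- The determinantal formula for `s^t_π`. -/
theorem schurTranspose_eq (π : SetPartition n) :
    schurTranspose π = permute (readingPerm π)
      (ncdet (Matrix.of fun i j : Fin ((shape π).colLen 0) =>
        eEntry (((shape π).rowLen i : ℤ) - i + j))) := by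
  rw [schurTranspose, schur, omega_permute, sourceSchur, omega_ncdet]

end Omega

end NCSym

/-! ### The elementary functions are linearly independent -/

/-- The sign of a permutation is determined by its orbits. -/
theorem Equiv.Perm.sign_eq_of_sameCycle_iff {α : Type*} [Fintype α] [DecidableEq α] {f g : Perm α}
    (hfg : ∀ x y, f.SameCycle x y ↔ g.SameCycle x y) : Perm.sign f = Perm.sign g := by
  have hprod : ∀ f : Perm α, Perm.sign f =
      ∏ S ∈ f.cycleFactorsFinset.image Perm.support, -(-1) ^ S.card := fun f => by
    rw [prod_image]
    · conv_lhs => rw [← f.cycleFactorsFinset_noncommProd]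
      rw [Finset.map_noncommProd, noncommProd_eq_prod]
      refine prod_congr rfl fun c hc => ?_
      exact (Perm.mem_cycleFactorsFinset_iff.1 hc).1.sign
    · intro c hc d hd hcd
      by_contra hne
      have hdis := f.cycleFactorsFinset_pairwise_disjoint hc hd hne
      rw [Perm.disjoint_iff_disjoint_support, show c.support = d.support from hcd,
        disjoint_self_iff_empty, Perm.support_eq_empty_iff] at hdis
      exact (Perm.mem_cycleFactorsFinset_iff.1 hd).1.ne_one hdis
  have himage : ∀ (f : Perm α) (S : Finset α), S ∈ f.cycleFactorsFinset.image Perm.support ↔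
      ∃ x y, x ≠ y ∧ f.SameCycle x y ∧ ∀ z, z ∈ S ↔ f.SameCycle x z := fun f S => by
    have hmem : ∀ x, x ∈ f.support → ∀ z, z ∈ (f.cycleOf x).support ↔ f.SameCycle x z :=
      fun x hx z => by
        rw [Perm.mem_support_cycleOf_iff]
        exact and_iff_left hx
    rw [mem_image]
    constructor
    · rintro ⟨c, hc, rfl⟩
      obtain ⟨x, hx⟩ := (Perm.mem_cycleFactorsFinset_iff.1 hc).1.nonempty_support
      have hxf := Perm.mem_cycleFactorsFinset_support_le hc hx
      rw [Perm.cycle_is_cycleOf hx hc]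
      exact ⟨x, f x, (Perm.mem_support.1 hxf).symm, ⟨1, by simp⟩, hmem x hxf⟩
    · rintro ⟨x, y, hxy, hc, hS⟩
      have hxf : x ∈ f.support := by
        rw [Perm.mem_support]
        intro hx
        exact hxy (hc.eq_of_left hx)
      refine ⟨f.cycleOf x, Perm.cycleOf_mem_cycleFactorsFinset_iff.2 hxf, ?_⟩
      ext z
      rw [hmem x hxf, hS]
  rw [hprod, hprod]
  refine prod_congr ?_ fun _ _ => rfl
  ext S
  simp only [himage, hfg]

namespace NCSym

variable {n : ℕ}

/-- The set partition whose blocks are the orbits of a permutation. -/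
def cyclePartition (g : Perm (Fin n)) : SetPartition n :=
  kerPartition (Quotient.mk (Perm.SameCycle.setoid g))

theorem part_cyclePartition_eq_iff (g : Perm (Fin n)) (x y : Fin n) :
    (cyclePartition g).part x = (cyclePartition g).part y ↔ g.SameCycle x y := by
  rw [cyclePartition, part_kerPartition_eq_iff, Quotient.eq]
  rfl

theorem cyclePartition_le_iff (g : Perm (Fin n)) (σ : SetPartition n) :
    cyclePartition g ≤ σ ↔ ∀ x, σ.part (g x) = σ.part x := by
  rw [le_iff_part]
  simp only [part_cyclePartition_eq_iff]
  refine ⟨fun H x => (H x (g x) ⟨1, by simp⟩).symm, fun H x y => ?_⟩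
  rintro ⟨k, rfl⟩
  have hinv : ∀ x, σ.part (g⁻¹ x) = σ.part x := fun x => by
    rw [← H (g⁻¹ x), ← Perm.mul_apply, mul_inv_cancel, Perm.one_apply]
  induction k generalizing x with
  | zero => rfl
  | succ k ih => rw [zpow_add_one, Perm.mul_apply, ← ih, H]
  | pred k ih => rw [zpow_sub_one, Perm.mul_apply, ← ih, hinv]

theorem cyclePartition_surjective : Function.Surjective (cyclePartition (n := n)) := fun π => by
  obtain ⟨g, hg, hg'⟩ := exists_perm_cycles π
  exact ⟨g, le_antisymm ((cyclePartition_le_iff g π).2 hg)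
    (hg' _ ((cyclePartition_le_iff g _).1 le_rfl))⟩

theorem sign_eq_of_cyclePartition_eq {f g : Perm (Fin n)}
    (hfg : cyclePartition f = cyclePartition g) : Perm.sign f = Perm.sign g :=
  Perm.sign_eq_of_sameCycle_iff fun x y => by
    rw [← part_cyclePartition_eq_iff, ← part_cyclePartition_eq_iff, hfg]

open scoped Classical in
theorem e_apply_word (π σ : SetPartition n) :
    (e π : NCSeries).coeff (List.ofFn (word σ)) =
      if Function.Injective (σ ⊓ π).part then 1 else 0 := by
  refine (tupleSeries_ofFn _ _).trans (if_congr ?_ rfl rfl)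
  simp only [Ne, word_eq_iff, Function.Injective, part_inf_eq_iff]
  constructor
  · intro H x y hxy
    by_contra hne
    exact H x y hne hxy.2 hxy.1
  · intro H x y hne hπ hσ
    exact hne (H ⟨hσ, hπ⟩)

open scoped Classical in
/-- The signs of the permutations that stabilize every block of a set partition cancel, unless
all blocks are singletons. -/
theorem sum_sign_cyclePartition_le (ρ : SetPartition n) :
    ∑ g : Perm (Fin n), (if cyclePartition g ≤ ρ then ((Perm.sign g : ℤ) : ℚ) else 0) =
      if Function.Injective ρ.part then 1 else 0 := by
  simp only [cyclePartition_le_iff]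
  by_cases hρ : Function.Injective ρ.part
  · rw [if_pos hρ, sum_eq_single 1]
    · simp
    · intro g _ hg
      refine if_neg fun H => hg (Equiv.ext fun x => hρ (H x))
    · simp
  · rw [if_neg hρ]
    simp only [Function.Injective, not_forall] at hρ
    obtain ⟨x, y, hxy, hne⟩ := hρ
    have hswap : ∀ z, ρ.part (Equiv.swap x y z) = ρ.part z := fun z => by
      by_cases hzx : z = x
      · rw [hzx, Equiv.swap_apply_left, hxy]
      · by_cases hzy : z = y
        · rw [hzy, Equiv.swap_apply_right, hxy]
        · rw [Equiv.swap_apply_of_ne_of_ne hzx hzy]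
    -- Multiplication by a transposition inside a block reverses the signs.
    refine sum_involution (fun g _ => Equiv.swap x y * g) ?_ ?_ ?_ ?_
    · intro g _
      simp only [Perm.mul_apply, hswap, Perm.sign_mul, Perm.sign_swap hne]
      split_ifs <;> simp
    · intro g _ _ hg
      rw [mul_eq_right, Equiv.swap_eq_one_iff] at hg
      exact hne hg
    · simp
    · intro g _
      rw [← mul_assoc, Equiv.swap_mul_self, one_mul]

/-- The matrix of the `e_π` in terms of the `m_σ` factors through the values of both partitions
on permutations, weighted by the signs; these weights do not cancel over the permutations with
given orbits. -/
theorem linearIndependent_e_coeff :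
    LinearIndependent ℚ fun π : SetPartition n =>
      (fun σ : SetPartition n => (e π : NCSeries).coeff (List.ofFn (word σ))) := by
  classical
  rw [Fintype.linearIndependent_iff]
  intro c hc
  -- `F` collects the coefficients of a linear relation above `τ`; it vanishes by induction from
  -- below, and then the coefficients vanish by induction from above.
  let F : SetPartition n → ℚ := fun τ => ∑ π, if τ ≤ π then c π else 0
  have hF : ∀ σ : SetPartition n, ∑ g : Perm (Fin n),
      (if cyclePartition g ≤ σ then ((Perm.sign g : ℤ) : ℚ) * F (cyclePartition g) else 0) = 0 := by
    intro σ
    have h1 : ∑ π, c π * (e π : NCSeries).coeff (List.ofFn (word σ)) = 0 := by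
      simpa using congrFun hc σ
    refine Eq.trans ?_ h1
    simp only [e_apply_word, ← sum_sign_cyclePartition_le, F, mul_sum]
    refine Eq.trans ?_ sum_comm
    refine sum_congr rfl fun g _ => ?_
    simp only [le_inf_iff]
    by_cases hg : cyclePartition g ≤ σ
    · simp only [hg, if_true, true_and, mul_ite, mul_zero]
      exact sum_congr rfl fun π _ => by split_ifs <;> ring
    · simp [hg]
  have hF0 : ∀ σ, F σ = 0 := by
    intro σ
    induction σ using WellFoundedLT.induction with
    | ind σ ih =>
      obtain ⟨g₀, hg₀⟩ := cyclePartition_surjective σ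
      have h1 := hF σ
      have h2 : ∀ g : Perm (Fin n), (if cyclePartition g ≤ σ then
          ((Perm.sign g : ℤ) : ℚ) * F (cyclePartition g) else 0) =
          (if cyclePartition g = σ then 1 else 0) * (((Perm.sign g₀ : ℤ) : ℚ) * F σ) := by
        intro g
        by_cases hg : cyclePartition g = σ
        · rw [if_pos hg.le, if_pos hg, one_mul, hg,
            sign_eq_of_cyclePartition_eq (hg.trans hg₀.symm)]
        · rw [if_neg hg, zero_mul]
          by_cases hle : cyclePartition g ≤ σ
          · rw [if_pos hle, ih _ (lt_of_le_of_ne hle hg), mul_zero]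
          · rw [if_neg hle]
      simp only [h2] at h1
      rw [← sum_mul, sum_boole, mul_eq_zero, mul_eq_zero] at h1
      rcases h1 with h1 | h1 | h1
      · rw [Nat.cast_eq_zero, card_eq_zero] at h1
        exact absurd hg₀ ((filter_eq_empty_iff.1 h1) (mem_univ g₀))
      · rcases Int.units_eq_one_or (Perm.sign g₀) with h3 | h3 <;> simp [h3] at h1
      · exact h1
  intro σ
  induction σ using WellFoundedGT.induction with
  | ind σ ih =>
    have h1 := hF0 σ
    simp only [F] at h1
    rw [sum_eq_single σ] at h1
    · simpa using h1
    · intro π _ hπ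
      by_cases hle : σ ≤ π
      · rw [if_pos hle, ih _ (lt_of_le_of_ne hle hπ.symm)]
      · rw [if_neg hle]
    · simp

theorem linearIndependent_e : LinearIndependent ℚ fun π : SetPartition n => e π := by
  let Φ : NCSym →ₗ[ℚ] (SetPartition n → ℚ) :=
    { toFun := fun f σ => (f : NCSeries).coeff (List.ofFn (word σ))
      map_add' := fun _ _ => rfl
      map_smul' := fun _ _ => rfl }
  exact LinearIndependent.of_comp Φ linearIndependent_e_coeff

end NCSym

/-! ### Rearrangement and sorted words -/

/-- The determinantal exponents `λ_i - i + ε(i)` of a non-identity permutation have a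
larger sum of squares than the parts `λ_i`, by the rearrangement inequality. -/
theorem Equiv.Perm.sum_sq_lt_sum_sq_add_sub {l : ℕ} {r : Fin l → ℤ} (hr : Antitone r)
    {ε : Perm (Fin l)} (hε : ε ≠ 1) :
    ∑ i, r i ^ 2 < ∑ i, (r i - (i : ℕ) + (ε i : ℕ)) ^ 2 := by
  let a : Fin l → ℤ := fun i => r i - (i : ℕ)
  let g : Fin l → ℤ := fun i => ((i : ℕ) : ℤ)
  have ha : StrictAnti a := fun i j hij => by
    have h1 := hr hij.le
    have h2 : (i : ℕ) < (j : ℕ) := hij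
    simp only [a]
    omega
  have hg : StrictMono g := fun i j hij => by
    have h2 : (i : ℕ) < (j : ℕ) := hij
    simpa [g] using h2
  have hlt : ∑ i, a i * g i < ∑ i, a i * g (ε i) := by
    have := (Antivary.sum_mul_lt_sum_mul_comp_perm_iff (σ := ε)
      (ha.antitone.antivary hg.monotone)).2 fun hav => hε ?_
    · simpa using this
    have hmono : StrictMono ε.symm := fun i j hij => by
      have h1 := hav (i := ε.symm i) (j := ε.symm j) (by simpa using hg hij)
      exact lt_of_le_of_ne (ha.le_iff_ge.1 h1) (ε.symm.injective.ne hij.ne)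
    have hid : (ε.symm : Fin l → Fin l) = id :=
      (hmono.range_inj strictMono_id).1 (by simp)
    refine Equiv.ext fun x => ?_
    have := congrFun hid (ε x)
    simpa using this.symm
  have hsq : ∑ i, g (ε i) ^ 2 = ∑ i, g i ^ 2 := Equiv.sum_comp ε fun i => g i ^ 2
  have h1 : ∑ i, (r i - (i : ℕ) + (ε i : ℕ)) ^ 2 =
      ∑ i, a i ^ 2 + 2 * ∑ i, a i * g (ε i) + ∑ i, g (ε i) ^ 2 := by
    rw [mul_sum, ← sum_add_distrib, ← sum_add_distrib]
    exact sum_congr rfl fun i _ => by simp only [a, g]; ring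
  have h2 : ∑ i, r i ^ 2 = ∑ i, a i ^ 2 + 2 * ∑ i, a i * g i + ∑ i, g i ^ 2 := by
    rw [mul_sum, ← sum_add_distrib, ← sum_add_distrib]
    exact sum_congr rfl fun i _ => by simp only [a, g]; ring
  rw [h1, h2, hsq]
  linarith

theorem List.count_flatMap_replicate {α : Type*} [BEq α] [LawfulBEq α] [DecidableEq α]
    {vs : List α} (hvs : vs.Nodup) (k : α → ℕ) (a : α) :
    (vs.flatMap fun b => List.replicate (k b) b).count a = if a ∈ vs then k a else 0 := by
  induction vs with
  | nil => simp
  | cons b vs ih =>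
    rw [List.nodup_cons] at hvs
    rw [List.flatMap_cons, List.count_append, ih hvs.2, List.count_replicate]
    by_cases hab : b = a
    · subst hab
      simp [hvs.1]
    · simp [hab, Ne.symm hab]

/-- A weakly increasing word is the concatenation of its constant runs. -/
theorem List.SortedLE.eq_flatMap_replicate {α : Type*} [LinearOrder α] [BEq α] [LawfulBEq α] {u vs : List α}
    (hu : u.SortedLE) (hvs : vs.SortedLT) (hmem : ∀ a, a ∈ vs ↔ a ∈ u) :
    u = vs.flatMap fun a => List.replicate (u.count a) a := by
  refine List.Perm.eq_of_sortedLE hu ?_ ?_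
  · rw [List.sortedLE_iff_pairwise, List.flatMap_def, List.pairwise_flatten]
    refine ⟨?_, ?_⟩
    · intro l hl
      obtain ⟨a, -, rfl⟩ := List.mem_map.1 hl
      exact List.pairwise_replicate.2 (Or.inr le_rfl)
    · rw [List.pairwise_map]
      refine hvs.pairwise.imp fun {a b} hab x hx y hy => ?_
      rw [List.eq_of_mem_replicate hx, List.eq_of_mem_replicate hy]
      exact hab.le
  · rw [List.perm_iff_count]
    intro a
    rw [List.count_flatMap_replicate hvs.nodup]
    split_ifs with ha
    · rfl
    · exact List.count_eq_zero.2 fun h' => ha ((hmem a).2 h')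

namespace NCSym

variable {n : ℕ}

/-! ### The shape of a set partition -/

theorem pos_of_mem_blockSizes {π : SetPartition n} {x : ℕ} (hx : x ∈ blockSizes π) : 0 < x := by
  rw [blockSizes, Multiset.mem_sort, Multiset.mem_map] at hx
  obtain ⟨B, hB, rfl⟩ := hx
  exact card_pos.2 (π.nonempty_of_mem_parts hB)

theorem rowLens_shape (π : SetPartition n) : (shape π).rowLens = blockSizes π :=
  YoungDiagram.rowLens_ofRowLens_eq_self fun _ hx => pos_of_mem_blockSizes hx

theorem ofFn_rowLen (μ : YoungDiagram) :
    (List.ofFn fun i : Fin (μ.colLen 0) => μ.rowLen i) = μ.rowLens :=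
  List.ext_get (by simp) fun i h1 h2 => by simp [YoungDiagram.rowLens]

theorem sum_rowLen_shape (π : SetPartition n) (φ : ℕ → ℕ) :
    ∑ i : Fin ((shape π).colLen 0), φ ((shape π).rowLen i) = ∑ B ∈ π.parts, φ B.card := by
  have h1 := congrArg (fun l => (l.map φ).sum) ((ofFn_rowLen (shape π)).trans (rowLens_shape π))
  simp only [List.map_ofFn, List.sum_ofFn, Function.comp_apply] at h1
  rw [h1, ← Multiset.sum_coe, ← Multiset.map_coe, blockSizes, Multiset.sort_eq, Multiset.map_map]
  rfl

/-- The sum of the squares of the block sizes. -/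
def sqSize (π : SetPartition n) : ℕ := ∑ B ∈ π.parts, B.card ^ 2

theorem sqSize_kerPartition {l : ℕ} (c : Fin n → Fin l) :
    sqSize (kerPartition c) = ∑ a, (List.ofFn c).count a ^ 2 := by
  rw [sqSize, parts_kerPartition, sum_image (filter_eq_injOn_image c)]
  simp only [← count_ofFn]
  refine sum_subset (subset_univ _) fun a _ ha => ?_
  rw [List.count_eq_zero.2, zero_pow two_ne_zero]
  intro h'
  obtain ⟨x, rfl⟩ := List.mem_ofFn.1 h'
  exact ha (mem_image_of_mem c (mem_univ x))

theorem sqSize_permutePartition (δ : Perm (Fin n)) {l : ℕ} (c : Fin n → Fin l) :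
    sqSize (permutePartition δ (kerPartition c)) = sqSize (kerPartition c) := by
  rw [permutePartition_kerPartition, sqSize_kerPartition, sqSize_kerPartition]
  exact sum_congr rfl fun a _ => by rw [(Equiv.Perm.ofFn_comp_perm δ.symm c).count_eq]

theorem count_segmentWord {l : ℕ} (k : Fin l → ℕ) (i : Fin l) :
    (segmentWord k).count i = k i := by
  rw [segmentWord, List.count_flatMap_replicate (List.nodup_finRange l), if_pos (List.mem_finRange i)]

theorem length_segmentWord {l : ℕ} (k : Fin l → ℕ) : (segmentWord k).length = ∑ i, k i := by
  simp [segmentWord, List.length_flatMap, ← List.ofFn_eq_map, List.sum_ofFn]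

/-! ### The reading permutation and unitriangularity -/

/-- The key by which the reading permutation sorts: larger blocks come first, then blocks with
smaller least element. -/
def readingKey (π : SetPartition n) (x : Fin n) : ℕᵒᵈ ×ₗ WithTop (Fin n) :=
  toLex (OrderDual.toDual (π.part x).card, (π.part x).min)

theorem readingKey_eq_iff (π : SetPartition n) (x y : Fin n) :
    readingKey π x = readingKey π y ↔ π.part x = π.part y := by
  refine ⟨fun hxy => ?_, fun hxy => by rw [readingKey, hxy, readingKey]⟩
  have h1 : (π.part x).min = (π.part y).min := congrArg (fun z => (ofLex z).2) hxy
  obtain ⟨a, ha⟩ := min_of_mem (π.mem_part (mem_univ x))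
  have hax := (part_eq_iff π a x).2 (mem_of_min ha)
  have hay := (part_eq_iff π a y).2 (mem_of_min (h1 ▸ ha))
  rw [← hax, hay]

theorem kerPartition_readingKey (π : SetPartition n) : kerPartition (readingKey π) = π :=
  (kerPartition_eq_iff _ _).2 (readingKey_eq_iff π)

theorem count_readingKey (π : SetPartition n) (x : Fin n) :
    (List.ofFn (readingKey π)).count (readingKey π x) = (π.part x).card := by
  rw [count_ofFn]
  congr 1
  ext y
  simp [readingKey_eq_iff, part_eq_iff]

/-- The multiplicities of the reading keys, in increasing order of the keys, are the block sizes
in decreasing order. -/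
theorem map_count_readingKey (π : SetPartition n) :
    ((univ.image (readingKey π)).sort (· ≤ ·)).map (fun a => (List.ofFn (readingKey π)).count a) =
      blockSizes π := by
  refine List.Perm.eq_of_sortedGE ?_ (blockSizes_sortedGE π) ?_
  · rw [List.sortedGE_iff_pairwise, List.pairwise_map]
    refine (pairwise_sort _ (· ≤ ·)).imp_of_mem fun {a b} ha hb hab => ?_
    rw [mem_sort, mem_image] at ha hb
    obtain ⟨x, -, rfl⟩ := ha
    obtain ⟨y, -, rfl⟩ := hb
    rw [count_readingKey, count_readingKey]
    rcases (Prod.Lex.le_iff).1 hab with hlt | ⟨heq, -⟩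
    · exact (OrderDual.toDual_lt_toDual.1 hlt).le
    · exact (OrderDual.toDual.injective heq).ge
  · rw [← Multiset.coe_eq_coe, ← Multiset.map_coe, Finset.sort_eq, blockSizes, Multiset.sort_eq]
    conv_rhs => rw [← kerPartition_readingKey π, parts_kerPartition,
      image_val_of_injOn (filter_eq_injOn_image (readingKey π)), Multiset.map_map]
    exact Multiset.map_congr rfl fun a _ => count_ofFn _ _

/-- The diagonal product of the determinant of `s^t_π`: the reading permutation arranges the places
so that the keys increase, and the runs of equal keys are segments of the lengths `λ_i`. -/
theorem prod_eEntry_rowLen (π : SetPartition n) : ∃ C : ℚ, C ≠ 0 ∧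
    (List.ofFn fun i : Fin ((shape π).colLen 0) => eEntry ((shape π).rowLen i)).prod =
      C • e (kerPartition (readingKey π ∘ readingPerm π)) := by
  let u := List.ofFn (readingKey π ∘ readingPerm π)
  let vs := (univ.image (readingKey π)).sort (· ≤ ·)
  have hperm : u.Perm (List.ofFn (readingKey π)) := Equiv.Perm.ofFn_comp_perm _ _
  have hu : u = vs.flatMap fun a => List.replicate (u.count a) a := by
    refine List.SortedLE.eq_flatMap_replicate ?_ (Finset.sortedLT_sort (univ.image (readingKey π))) fun a => ?_
    · exact (Tuple.monotone_sort (readingKey π)).sortedLE_ofFn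
    · rw [hperm.mem_iff, mem_sort, List.mem_ofFn]
      simp
  have hsizes : (List.ofFn fun i : Fin ((shape π).colLen 0) => (shape π).rowLen i) =
      vs.map fun a => u.count a := by
    rw [ofFn_rowLen, rowLens_shape, ← map_count_readingKey]
    exact List.map_congr_left fun a _ => (hperm.count_eq a).symm
  have hlist : (List.ofFn fun i : Fin ((shape π).colLen 0) => eEntry ((shape π).rowLen i)) =
      vs.map fun a => (1 / ((u.count a).factorial : ℚ)) • e (⊤ : SetPartition (u.count a)) := by
    have := congrArg (List.map fun k : ℕ => eEntry k) hsizes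
    rw [List.map_ofFn, List.map_map] at this
    refine this.trans (List.map_congr_left fun a _ => ?_)
    simp [eEntry]
  refine ⟨(vs.map fun a => 1 / ((u.count a).factorial : ℚ)).prod, ?_, ?_⟩
  · refine List.prod_ne_zero fun h0 => ?_
    obtain ⟨a, -, ha⟩ := List.mem_map.1 h0
    exact one_div_ne_zero (Nat.cast_ne_zero.2 (Nat.factorial_ne_zero _)) ha
  · rw [hlist, prod_map_smul, prod_e_top (Finset.sort_nodup _ _), ← hu, eWord_ofFn]

/-- Up to terms `e_σ` with `σ` of larger sum of squares of block sizes, `s^t_π` is a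
nonzero multiple of `e_π`. -/
theorem schurTranspose_triangular (π : SetPartition n) : ∃ C : ℚ, C ≠ 0 ∧
    schurTranspose π - C • e π ∈ Submodule.span ℚ (e '' {σ : SetPartition n | sqSize π < sqSize σ}) := by
  obtain ⟨C, hC, hprod⟩ := prod_eEntry_rowLen π
  refine ⟨C, hC, ?_⟩
  have hlead : permute (readingPerm π) (C • e (kerPartition (readingKey π ∘ readingPerm π))) =
      C • e π := by
    rw [map_smul, permute_e, permutePartition_kerPartition, Function.comp_assoc]
    simp [kerPartition_readingKey]
  rw [schurTranspose_eq, ncdet, ← add_sum_erase _ _ (mem_univ 1), map_add]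
  have hone : (List.ofFn fun i : Fin ((shape π).colLen 0) =>
      Matrix.of (fun i j : Fin ((shape π).colLen 0) =>
        eEntry (((shape π).rowLen i : ℤ) - i + j)) i ((1 : Perm (Fin ((shape π).colLen 0))) i)) =
      List.ofFn fun i : Fin ((shape π).colLen 0) => eEntry ((shape π).rowLen i) := by
    congr 1
    funext i
    simp
  rw [hone, hprod, Perm.sign_one, one_smul, hlead, add_sub_cancel_left, map_sum]
  refine Submodule.sum_mem _ fun ε hε => ?_
  rw [Units.smul_def, map_zsmul]
  refine Submodule.smul_of_tower_mem _ _ ?_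
  simp only [Matrix.of_apply]
  set z : Fin ((shape π).colLen 0) → ℤ := fun i => ((shape π).rowLen i : ℤ) - i + (ε i : ℕ) with hz
  change permute _ (List.ofFn fun i => eEntry (z i)).prod ∈ _
  by_cases hz0 : ∀ i, 0 ≤ z i
  · lift z to Fin ((shape π).colLen 0) → ℕ using hz0 with k
    rw [prod_eEntry, map_smul]
    refine Submodule.smul_mem _ _ ?_
    have hk : ∀ i, (k i : ℤ) = ((shape π).rowLen i : ℤ) - i + (ε i : ℕ) := fun i => congrFun hz i
    have hsum : ∑ i, k i = n := by
      have h1 := sum_rowLen_shape π id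
      simp only [id, π.sum_card_parts, card_univ, Fintype.card_fin] at h1
      zify
      simp only [hk, sum_add_distrib, sum_sub_distrib]
      rw [Equiv.sum_comp ε fun i => ((i : ℕ) : ℤ), sub_add_cancel]
      exact_mod_cast h1
    obtain ⟨c, hc⟩ := exists_eq_ofFn ((length_segmentWord k).trans hsum)
    rw [hc, eWord_ofFn, permute_e]
    refine Submodule.subset_span ⟨_, ?_, rfl⟩
    rw [Set.mem_ofPred_eq, sqSize_permutePartition, sqSize_kerPartition, ← hc]
    simp only [count_segmentWord]
    rw [sqSize, ← sum_rowLen_shape π fun x => x ^ 2]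
    zify
    simp only [hk]
    refine Perm.sum_sq_lt_sum_sq_add_sub
      (r := fun i : Fin ((shape π).colLen 0) => ((shape π).rowLen i : ℤ)) (fun i j hij => ?_)
      (ne_of_mem_erase hε)
    exact Nat.cast_le.2 ((shape π).rowLen_anti i j hij)
  · push Not at hz0
    obtain ⟨i, hi⟩ := hz0
    rw [prod_eEntry_of_neg hi, map_zero]
    exact Submodule.zero_mem _

theorem schurTranspose_mem_span_e (π : SetPartition n) :
    schurTranspose π ∈ Submodule.span ℚ (Set.range (e (n := n))) := by
  obtain ⟨C, -, hC⟩ := schurTranspose_triangular π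
  rw [← sub_add_cancel (schurTranspose π) (C • e π)]
  exact Submodule.add_mem _ (Submodule.span_mono (Set.image_subset_range _ _) hC)
    (Submodule.smul_mem _ _ (Submodule.subset_span ⟨π, rfl⟩))

theorem e_mem_span_schurTranspose (π : SetPartition n) :
    e π ∈ Submodule.span ℚ (Set.range (schurTranspose (n := n))) := by
  have hwf : WellFounded fun σ π : SetPartition n => sqSize π < sqSize σ :=
    have : IsTrans (SetPartition n) fun σ π => sqSize π < sqSize σ :=
      ⟨fun _ _ _ h1 h2 => h2.trans h1⟩
    have : Std.Irrefl fun σ π : SetPartition n => sqSize π < sqSize σ := ⟨fun _ => lt_irrefl _⟩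
    Finite.wellFounded_of_trans_of_irrefl _
  induction π using hwf.induction with
  | _ π ih =>
    obtain ⟨C, hC, hmem⟩ := schurTranspose_triangular π
    have h1 : Submodule.span ℚ (e '' {σ : SetPartition n | sqSize π < sqSize σ}) ≤
        Submodule.span ℚ (Set.range (schurTranspose (n := n))) := by
      rw [Submodule.span_le]
      rintro _ ⟨σ, hσ, rfl⟩
      exact ih σ hσ
    have h2 : C • e π ∈ Submodule.span ℚ (Set.range (schurTranspose (n := n))) := by
      rw [← sub_sub_cancel (schurTranspose π) (C • e π)]
      exact Submodule.sub_mem _ (Submodule.subset_span ⟨π, rfl⟩) (h1 hmem)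
    exact (Submodule.smul_mem_iff _ hC).1 h2

theorem linearIndependent_schurTranspose :
    LinearIndependent ℚ (schurTranspose (n := n)) := by
  rw [linearIndependent_iff_card_le_finrank_span]
  have h1 := linearIndependent_iff_card_le_finrank_span.1 (linearIndependent_e (n := n))
  refine h1.trans ?_
  have := FiniteDimensional.span_of_finite ℚ (Set.finite_range (schurTranspose (n := n)))
  refine Submodule.finrank_mono (Submodule.span_le.2 ?_)
  rintro _ ⟨π, rfl⟩
  exact e_mem_span_schurTranspose π

/-! ### Homogeneous bases -/

theorem eq_sum_m_of_homogeneous {f : NCSym}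
    (hf : ∀ w : List ℕ, w.length ≠ n → (f : NCSeries).coeff w = 0) :
    f = ∑ σ : SetPartition n, (f : NCSeries).coeff (List.ofFn (word σ)) • m σ := by
  classical
  refine Subtype.ext (NCSeries.ext_coeff fun w => ?_)
  have hR : ((∑ σ : SetPartition n, (f : NCSeries).coeff (List.ofFn (word σ)) • m σ : NCSym) :
      NCSeries).coeff w = ∑ σ : SetPartition n,
      (f : NCSeries).coeff (List.ofFn (word σ)) * (m σ : NCSeries).coeff w := by
    simp [NCSeries.coeff_sum]
  rw [hR]
  by_cases hw : w.length = n
  · obtain ⟨i, rfl⟩ := exists_eq_ofFn hw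
    have hi : ∀ j k, i j = i k ↔ word (kerPartition i) j = word (kerPartition i) k := fun j k => by
      rw [word_eq_iff, part_kerPartition_eq_iff]
    rw [apply_eq_of_ker_eq f _ _ hi]
    simp only [fun σ : SetPartition n => apply_eq_of_ker_eq (m σ) _ _ hi, m_apply_word]
    simp
  · rw [hf w hw]
    exact (sum_eq_zero fun σ _ => by
      rw [show (m σ : NCSeries).coeff w = 0 from tupleSeries_of_length_ne _ hw, mul_zero]).symm

/-- Homogeneous families that are linearly independent in each degree and indexed by the set
partitions of `[n]` in degree `n` are bases: the homogeneous part of degree `n` is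
spanned by as many functions `m_σ`. -/
theorem basis_of_homogeneous {v : ∀ n, SetPartition n → NCSym}
    (hv : ∀ n π, ∀ w : List ℕ, w.length ≠ n → (v n π : NCSeries).coeff w = 0)
    (hli : ∀ n, LinearIndependent ℚ (v n)) :
    LinearIndependent ℚ (fun π : Σ n, SetPartition n => v π.1 π.2) ∧
      Submodule.span ℚ (Set.range fun π : Σ n, SetPartition n => v π.1 π.2) = ⊤ := by
  classical
  constructor
  · -- `P n` is the projection to the homogeneous part of degree `n`.
    let P : ℕ → NCSym →ₗ[ℚ] NCSeries := fun n =>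
      { toFun := fun f => ⟨fun w => if w.length = n then (f : NCSeries).coeff w else 0⟩
        map_add' := fun f g => NCSeries.ext_coeff fun w => by
          simp only [NCSeries.coeff_add, Subalgebra.coe_add]
          split_ifs <;> simp
        map_smul' := fun c f => NCSeries.ext_coeff fun w => by
          simp only [NCSeries.coeff_smul, Subalgebra.coe_smul, RingHom.id_apply]
          split_ifs <;> simp }
    have hPeq : ∀ n (π : SetPartition n), P n (v n π) = (v n π : NCSeries) := fun n π =>
      NCSeries.ext_coeff fun w => by
        change (if w.length = n then _ else 0) = _
        split_ifs with hw
        · rfl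
        · rw [hv n π w hw]
    have hPne : ∀ n k (π : SetPartition k), k ≠ n → P n (v k π) = 0 := fun n k π hk =>
      NCSeries.ext_coeff fun w => by
        change (if w.length = n then _ else 0) = _
        split_ifs with hw
        · exact hv k π w (by omega)
        · rfl
    rw [linearIndependent_iff]
    intro c hc
    have hcn : ∀ n, c.split n = 0 := fun n => by
      refine linearIndependent_iff.1 (hli n) _ (Subtype.ext ?_)
      have h1 := congrArg (P n) hc
      rw [map_zero, Finsupp.linearCombination_apply, Finsupp.sum, map_sum] at h1
      rw [Finsupp.linearCombination_apply, Finsupp.sum_fintype _ _ (by simp)]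
      rw [Subalgebra.coe_zero, ← h1, ← NCSym.coe_val, map_sum]
      have h2 : ∀ p ∈ c.support, p ∉ (univ : Finset (SetPartition n)).map
          (Function.Embedding.sigmaMk n) → P n (c p • v p.1 p.2) = 0 := by
        rintro ⟨k, π⟩ - hp
        rw [map_smul, hPne n k π, smul_zero]
        rintro rfl
        exact hp (mem_map.2 ⟨π, mem_univ _, rfl⟩)
      have h3 : ∑ p ∈ c.support, P n (c p • v p.1 p.2) =
          ∑ p ∈ (univ : Finset (SetPartition n)).map (Function.Embedding.sigmaMk n),
            P n (c p • v p.1 p.2) := by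
        rw [← sum_subset inter_subset_left (fun p hp hp' => h2 p hp fun h' =>
          hp' (mem_inter.2 ⟨hp, h'⟩))]
        refine sum_subset inter_subset_right fun p hp hp' => ?_
        rw [Finsupp.notMem_support_iff.1 fun h' => hp' (mem_inter.2 ⟨h', hp⟩), zero_smul, map_zero]
      rw [h3, sum_map]
      refine sum_congr rfl fun π _ => ?_
      rw [Function.Embedding.sigmaMk_apply, map_smul, map_smul, Finsupp.split_apply]
      exact congrArg (c ⟨n, π⟩ • ·) (hPeq n π).symm
    ext ⟨n, π⟩
    have := DFunLike.congr_fun (hcn n) π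
    simpa [Finsupp.split_apply] using this
  · have hm : ∀ n, Submodule.span ℚ (Set.range (v n)) =
        Submodule.span ℚ (Set.range (m (n := n))) := fun n => by
      have := FiniteDimensional.span_of_finite ℚ (Set.finite_range (m (n := n)))
      refine Submodule.eq_of_le_of_finrank_le (Submodule.span_le.2 ?_) ?_
      · rintro _ ⟨π, rfl⟩
        rw [SetLike.mem_coe, eq_sum_m_of_homogeneous (hv n π)]
        exact Submodule.sum_mem _ fun σ _ =>
          Submodule.smul_mem _ _ (Submodule.subset_span ⟨σ, rfl⟩)
      · exact (finrank_range_le_card _).trans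
          (linearIndependent_iff_card_le_finrank_span.1 (hli n))
    rw [eq_top_iff, ← top_le_iff.1 span_h, Submodule.span_le]
    rintro _ ⟨⟨n, π⟩, rfl⟩
    refine Submodule.span_mono (s := Set.range (v n)) ?_ ?_
    · rintro _ ⟨σ, rfl⟩
      exact ⟨⟨n, σ⟩, rfl⟩
    · rw [hm]
      exact Submodule.sum_mem _ fun σ _ => Submodule.smul_mem _ _ (Submodule.subset_span ⟨σ, rfl⟩)

theorem schurTranspose_apply_of_length_ne (π : SetPartition n) {w : List ℕ} (hw : w.length ≠ n) :
    (schurTranspose π : NCSeries).coeff w = 0 := by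
  refine Submodule.span_induction (p := fun (f : NCSym) _ => (f : NCSeries).coeff w = 0) ?_ ?_ ?_ ?_
    (schurTranspose_mem_span_e π)
  · rintro _ ⟨σ, rfl⟩
    exact e_apply_of_length_ne σ hw
  · rfl
  · intro f g _ _ hf hg
    simp [hf, hg]
  · intro c f _ hf
    simp [hf]

end NCSym

/-! ### Letting the variables commute -/

/-- The elementary symmetric function `e_k` in the commuting variables `x₀, x₁, …`: the sum of all
squarefree monomials of degree `k`. It is `0` for negative `k`. -/
def symE (k : ℤ) : MvPowerSeries ℕ ℚ := by
  classical
  exact fun d => if (d.degree : ℤ) = k ∧ ∀ i, d i ≤ 1 then 1 else 0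

namespace NCSym

variable {n : ℕ}

theorem mem_words_iff_toFinsupp (d : ℕ →₀ ℕ) (w : List ℕ) :
    w ∈ (Finsupp.toMultiset d).lists.toFinset ↔ Multiset.toFinsupp (w : Multiset ℕ) = d := by
  rw [mem_words_iff, Finsupp.ext_iff]
  simp

theorem coeff_rho (f : NCSeries) (d : ℕ →₀ ℕ) :
    MvPowerSeries.coeff d (rho f) = ∑ w ∈ (Finsupp.toMultiset d).lists.toFinset, f.coeff w := rfl

theorem rho_mul (f g : NCSeries) : rho (f * g) = rho f * rho g := by
  ext d
  rw [MvPowerSeries.coeff_mul]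
  simp only [coeff_rho, NCSeries.coeff_mul, sum_mul_sum, ← sum_product', sum_sigma']
  -- A factorization of a word with content `d` is a pair of words whose contents add up to `d`.
  refine sum_bij'
    (fun x _ => ⟨(Multiset.toFinsupp (x.1.take x.2 : Multiset ℕ),
      Multiset.toFinsupp (x.1.drop x.2 : Multiset ℕ)), (x.1.take x.2, x.1.drop x.2)⟩)
    (fun y _ => ⟨y.2.1 ++ y.2.2, y.2.1.length⟩) ?_ ?_ ?_ ?_ ?_
  · rintro ⟨w, k⟩ hx
    simp only [mem_sigma, mem_words_iff_toFinsupp, mem_range] at hx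
    simp only [mem_sigma, HasAntidiagonal.mem_antidiagonal, mem_product, mem_words_iff_toFinsupp, and_true]
    rw [← hx.1, ← map_add, Multiset.coe_add, List.take_append_drop]
  · rintro ⟨⟨d1, d2⟩, w1, w2⟩ hy
    simp only [mem_sigma, HasAntidiagonal.mem_antidiagonal, mem_product, mem_words_iff_toFinsupp] at hy
    simp only [mem_sigma, mem_words_iff_toFinsupp, mem_range, List.length_append]
    refine ⟨?_, by omega⟩
    rw [← Multiset.coe_add, map_add, hy.2.1, hy.2.2, hy.1]
  · rintro ⟨w, k⟩ hx
    simp only [mem_sigma, mem_range] at hx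
    simp only [List.take_append_drop, List.length_take]
    rw [min_eq_left (by omega)]
  · rintro ⟨⟨d1, d2⟩, w1, w2⟩ hy
    simp only [mem_sigma, HasAntidiagonal.mem_antidiagonal, mem_product, mem_words_iff_toFinsupp] at hy
    obtain ⟨-, rfl, rfl⟩ := hy
    simp
  · rintro ⟨w, k⟩ -
    rfl

theorem rho_one : rho 1 = 1 := by
  ext d
  rw [coeff_rho, MvPowerSeries.coeff_one]
  simp only [NCSeries.coeff_one, sum_ite_eq', mem_words_iff_toFinsupp]
  simp [eq_comm]

/-- The algebra homomorphism that lets the variables of elements of `NCSym` commute. -/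
def rhoHom : NCSym →ₐ[ℚ] MvPowerSeries ℕ ℚ :=
  (AlgHom.ofLinearMap rho rho_one rho_mul).comp NCSym.val

theorem rhoHom_apply (f : NCSym) : rhoHom f = rho (f : NCSeries) := rfl

theorem permuteWord_perm (δ : Perm (Fin n)) (w : List ℕ) : (permuteWord δ w).Perm w := by
  by_cases hw : w.length = n
  · obtain ⟨i, rfl⟩ := exists_eq_ofFn hw
    rw [permuteWord_ofFn]
    exact Equiv.Perm.ofFn_comp_perm δ i
  · rw [permuteWord_of_length_ne δ hw]

theorem permuteWord_permuteWord_symm (δ : Perm (Fin n)) (w : List ℕ) :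
    permuteWord δ (permuteWord δ.symm w) = w := by
  by_cases hw : w.length = n
  · obtain ⟨i, rfl⟩ := exists_eq_ofFn hw
    rw [permuteWord_ofFn, permuteWord_ofFn, Function.comp_assoc]
    simp
  · rw [permuteWord_of_length_ne δ.symm hw, permuteWord_of_length_ne δ hw]

theorem rhoHom_permute (δ : Perm (Fin n)) (f : NCSym) : rhoHom (permute δ f) = rhoHom f := by
  ext d
  rw [rhoHom_apply, rhoHom_apply, coeff_rho, coeff_rho]
  have hmem : ∀ (δ : Perm (Fin n)), ∀ w ∈ (Finsupp.toMultiset d).lists.toFinset,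
      permuteWord δ w ∈ (Finsupp.toMultiset d).lists.toFinset := fun δ w hw => by
    rw [mem_words_iff] at hw ⊢
    intro i
    rw [(permuteWord_perm δ w).count_eq, hw]
  refine sum_nbij' (permuteWord δ) (permuteWord δ.symm) (hmem δ) (hmem δ.symm) ?_ ?_ ?_
  · intro w _
    simpa using permuteWord_permuteWord_symm δ.symm w
  · intro w _
    exact permuteWord_permuteWord_symm δ w
  · intro w _
    rfl

theorem coeff_e_top (k : ℕ) (w : List ℕ) : (e (⊤ : SetPartition k) : NCSeries).coeff w =
    if w.length = k ∧ w.Nodup then 1 else 0 := by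
  by_cases hw : w.length = k
  · obtain ⟨i, rfl⟩ := exists_eq_ofFn hw
    rw [← kerPartition_const k (), coeff_e_kerPartition]
    refine if_congr ?_ rfl rfl
    simp [List.nodup_ofFn, Function.Injective]
  · rw [e_apply_of_length_ne _ hw, if_neg fun h' => hw h'.1]

theorem card_words {d : ℕ →₀ ℕ} (hd : ∀ i, d i ≤ 1) :
    (Finsupp.toMultiset d).lists.toFinset.card = d.degree.factorial := by
  have hnd : (Finsupp.toMultiset d).Nodup := by
    rw [Multiset.nodup_iff_count_le_one]
    simpa [Finsupp.count_toMultiset] using hd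
  have hcard : (Finsupp.toMultiset d).card = d.degree := by
    rw [Finsupp.card_toMultiset]
    rfl
  rw [← hcard]
  generalize Finsupp.toMultiset d = s at hnd
  induction s using Quotient.inductionOn with
  | _ l =>
    have hl : l.Nodup := hnd
    change (Multiset.lists (l : Multiset ℕ)).toFinset.card = _
    rw [Multiset.lists_coe, List.toFinset_coe]
    rw [List.toFinset_card_of_nodup (List.nodup_permutations l hl), List.length_permutations]
    rfl

theorem rhoHom_eEntry (k : ℤ) : rhoHom (eEntry k) = symE k := by
  classical
  ext d
  have hE : MvPowerSeries.coeff d (symE k) =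
    if (d.degree : ℤ) = k ∧ ∀ i, d i ≤ 1 then 1 else 0 := rfl
  rw [hE]
  by_cases hk : 0 ≤ k
  · lift k to ℕ using hk
    simp only [eEntry, Nat.cast_nonneg, if_true, Int.toNat_natCast, Nat.cast_inj]
    rw [map_smul, map_smul, rhoHom_apply, coeff_rho, smul_eq_mul]
    simp only [coeff_e_top]
    have hiff : ∀ w ∈ (Finsupp.toMultiset d).lists.toFinset,
        (w.length = k ∧ w.Nodup ↔ d.degree = k ∧ ∀ i, d i ≤ 1) := fun w hw => by
      have hlen : w.length = d.degree := by
        rw [Multiset.mem_toFinset, Multiset.mem_lists_iff] at hw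
        have := congrArg Multiset.card hw
        rw [Finsupp.card_toMultiset] at this
        exact this.symm
      rw [mem_words_iff] at hw
      rw [hlen, List.nodup_iff_count_le_one]
      simp only [hw]
    rw [sum_congr rfl fun w hw => if_congr (hiff w hw) rfl rfl]
    split_ifs with hd
    · rw [sum_const, card_words hd.2, hd.1, nsmul_eq_mul, mul_one, one_div_mul_cancel]
      exact Nat.cast_ne_zero.2 (Nat.factorial_ne_zero _)
    · simp
  · rw [eEntry, if_neg hk, map_zero, map_zero, if_neg]
    rintro ⟨hd, -⟩
    omega

theorem map_ncdet {R S : Type*} [Ring R] [CommRing S] (φ : R →+* S) {k : ℕ}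
    (A : Matrix (Fin k) (Fin k) R) : φ (ncdet A) = (A.map φ).det := by
  rw [ncdet, map_sum, ← Matrix.det_transpose, Matrix.det_apply]
  refine sum_congr rfl fun ε _ => ?_
  rw [Units.smul_def, Units.smul_def, map_zsmul, map_list_prod, List.map_ofFn, List.prod_ofFn]
  rfl

/-- The image of `s^t_π` in commuting variables is the dual Jacobi–Trudi determinant. -/
theorem rho_schurTranspose (π : SetPartition n) :
    rho (schurTranspose π : NCSeries) = Matrix.det (Matrix.of
      fun i j : Fin ((shape π).colLen 0) => symE (((shape π).rowLen i : ℤ) - i + j)) := by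
  rw [← rhoHom_apply, schurTranspose_eq, rhoHom_permute]
  refine (map_ncdet (rhoHom : NCSym →+* MvPowerSeries ℕ ℚ) _).trans ?_
  congr 1
  ext1 i j
  exact rhoHom_eEntry _

end NCSym

/-! ### The dual Jacobi–Trudi identity -/

namespace YoungDiagram

variable (μ : YoungDiagram)

theorem colLen_le (j : ℕ) : μ.colLen j ≤ μ.colLen 0 := μ.colLen_anti 0 j (Nat.zero_le _)

theorem rowLen_le (i : ℕ) : μ.rowLen i ≤ μ.rowLen 0 := μ.rowLen_anti 0 i (Nat.zero_le _)

/-- With `k` the number of rows, the places `x < k` are sent to the numbers `μ_{k-1-x} + x` and the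
places `x ≥ k` to `x - μᵗ_{x-k}`. These are two increasing sequences, which
partition the numbers less than the sum of the numbers of rows and of columns. -/
def maya (x : ℕ) : ℕ :=
  if x < μ.colLen 0 then μ.rowLen (μ.colLen 0 - 1 - x) + x else x - μ.colLen (x - μ.colLen 0)

theorem maya_lt_of_lt_lt {x y : ℕ} (hxy : x < y) (hy : y < μ.colLen 0) : μ.maya x < μ.maya y := by
  have := μ.rowLen_anti (μ.colLen 0 - 1 - y) (μ.colLen 0 - 1 - x) (by omega)
  rw [maya, maya, if_pos (hxy.trans hy), if_pos hy]
  omega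

theorem maya_lt_of_le_lt {x y : ℕ} (hx : μ.colLen 0 ≤ x) (hxy : x < y) : μ.maya x < μ.maya y := by
  have h1 := μ.colLen_anti (x - μ.colLen 0) (y - μ.colLen 0) (by omega)
  have h2 := μ.colLen_le (x - μ.colLen 0)
  rw [maya, maya, if_neg hx.not_gt, if_neg (hx.trans hxy.le).not_gt]
  omega

/-- The inversions of `maya` are the cells of the diagram. -/
theorem maya_lt_iff {x y : ℕ} (hx : x < μ.colLen 0) (hy : μ.colLen 0 ≤ y) :
    μ.maya x < μ.maya y ↔ ¬ μ.colLen 0 - 1 - x < μ.colLen (y - μ.colLen 0) := by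
  have h1 := (μ.mem_iff_lt_rowLen (i := μ.colLen 0 - 1 - x) (j := y - μ.colLen 0)).symm.trans
    μ.mem_iff_lt_colLen
  have h2 := μ.colLen_le (y - μ.colLen 0)
  rw [maya, maya, if_pos hx, if_neg hy.not_gt]
  omega

theorem maya_ne {x y : ℕ} (hxy : x < y) : μ.maya x ≠ μ.maya y := by
  by_cases hy : y < μ.colLen 0
  · exact (μ.maya_lt_of_lt_lt hxy hy).ne
  · push Not at hy
    by_cases hx : x < μ.colLen 0
    · have h1 := (μ.mem_iff_lt_rowLen (i := μ.colLen 0 - 1 - x) (j := y - μ.colLen 0)).symm.trans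
        μ.mem_iff_lt_colLen
      have h2 := μ.colLen_le (y - μ.colLen 0)
      rw [maya, maya, if_pos hx, if_neg hy.not_gt]
      omega
    · exact (μ.maya_lt_of_le_lt (not_lt.1 hx) hxy).ne

theorem maya_lt {x : ℕ} (hx : x < μ.colLen 0 + μ.rowLen 0) :
    μ.maya x < μ.colLen 0 + μ.rowLen 0 := by
  have := μ.rowLen_le (μ.colLen 0 - 1 - x)
  rw [maya]
  split_ifs <;> omega

/-- The function `maya` as a permutation of the numbers less than the sum of the numbers of rows and
of columns. -/
def mayaPerm : Perm (Fin (μ.colLen 0 + μ.rowLen 0)) :=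
  Equiv.ofBijective (fun x => ⟨μ.maya x, μ.maya_lt x.2⟩) <| Finite.injective_iff_bijective.1 <| by
    intro x y hxy
    have hxy' : μ.maya x = μ.maya y := congrArg Fin.val hxy
    by_contra hne
    rcases lt_or_gt_of_ne (Fin.val_injective.ne hne) with hlt | hlt
    · exact μ.maya_ne hlt hxy'
    · exact μ.maya_ne hlt hxy'.symm

/-- The sign of the permutation is `(-1)^|μ|`, counted by columns. -/
theorem sign_mayaPerm : Perm.sign μ.mayaPerm = ∏ j : Fin (μ.rowLen 0), (-1) ^ μ.colLen j := by
  rw [Perm.sign_eq_prod_prod_Iio, Fin.prod_univ_add]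
  have hleft : ∀ j : Fin (μ.colLen 0), (∏ i ∈ Iio (Fin.castAdd (μ.rowLen 0) j),
      if μ.mayaPerm i < μ.mayaPerm (Fin.castAdd (μ.rowLen 0) j) then (1 : ℤˣ) else -1) = 1 :=
    fun j => prod_eq_one fun i hi =>
      if_pos (μ.maya_lt_of_lt_lt (x := i) (y := j) (Fin.lt_def.1 (mem_Iio.1 hi)) j.2)
  rw [prod_congr rfl fun j _ => hleft j, prod_const_one, one_mul]
  refine prod_congr rfl fun j _ => ?_
  have hfilter : Iio (Fin.natAdd (μ.colLen 0) j) =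
      univ.filter fun i => i < Fin.natAdd (μ.colLen 0) j := by
    ext i
    simp
  rw [hfilter, prod_filter, Fin.prod_univ_add]
  have hright : ∀ i : Fin (μ.rowLen 0), (if Fin.natAdd (μ.colLen 0) i < Fin.natAdd (μ.colLen 0) j
      then if μ.mayaPerm (Fin.natAdd (μ.colLen 0) i) < μ.mayaPerm (Fin.natAdd (μ.colLen 0) j)
        then (1 : ℤˣ) else -1 else 1) = 1 := fun i => by
    split_ifs with h1 h2
    · rfl
    · exact absurd (μ.maya_lt_of_le_lt (x := μ.colLen 0 + i) (y := μ.colLen 0 + j)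
        (Nat.le_add_right _ _) h1) h2
    · rfl
  rw [prod_congr rfl fun i _ => hright i, prod_const_one, mul_one,
    ← Equiv.prod_comp Fin.revPerm]
  have hcell : ∀ i : Fin (μ.colLen 0), (if Fin.castAdd (μ.rowLen 0) (Fin.revPerm i) <
      Fin.natAdd (μ.colLen 0) j then if μ.mayaPerm (Fin.castAdd (μ.rowLen 0) (Fin.revPerm i)) <
        μ.mayaPerm (Fin.natAdd (μ.colLen 0) j) then (1 : ℤˣ) else -1 else 1) =
      (fun i : ℕ => if i < μ.colLen j then -1 else 1) i := fun i => by
    have h0 : Fin.castAdd (μ.rowLen 0) (Fin.revPerm i) < Fin.natAdd (μ.colLen 0) j := by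
      rw [Fin.lt_def, Fin.val_castAdd, Fin.val_natAdd]
      omega
    have h1 := μ.maya_lt_iff (x := (Fin.revPerm i : Fin _)) (y := μ.colLen 0 + j) (Fin.is_lt _)
      (Nat.le_add_right _ _)
    have h2 : μ.colLen 0 - 1 - ((Fin.revPerm i : Fin (μ.colLen 0)) : ℕ) = i := by
      rw [Fin.revPerm_apply, Fin.val_rev]
      omega
    rw [h2, Nat.add_sub_cancel_left] at h1
    rw [if_pos h0]
    by_cases hi : (i : ℕ) < μ.colLen j
    · exact (if_neg fun h' => h1.1 h' hi).trans (if_pos hi).symm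
    · exact (if_pos (h1.2 hi)).trans (if_neg hi).symm
  rw [prod_congr rfl fun i _ => hcell i,
    Fin.prod_univ_eq_prod_range (fun i : ℕ => if i < μ.colLen j then (-1 : ℤˣ) else 1),
    ← prod_subset (range_subset_range.2 (μ.colLen_le j)) fun i _ hi =>
    if_neg fun h' => hi (mem_range.2 h')]
  rw [prod_congr rfl fun i hi => if_pos (mem_range.1 hi), prod_const, card_range]

end YoungDiagram

/-- Jacobi's identity for complementary minors of two inverse matrices. -/
theorem Matrix.det_toBlocks₁₁_of_mul_eq_one {p q R : Type*} [Fintype p] [Fintype q] [DecidableEq p]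
    [DecidableEq q] [CommRing R] {A B : Matrix (p ⊕ q) (p ⊕ q) R} (hAB : A * B = 1) :
    A.toBlocks₁₁.det = A.det * B.toBlocks₂₂.det := by
  have hmul := hAB
  rw [← fromBlocks_toBlocks A, ← fromBlocks_toBlocks B, fromBlocks_multiply,
    ← fromBlocks_one, fromBlocks_inj] at hmul
  have h1 : A * fromBlocks 1 B.toBlocks₁₂ 0 B.toBlocks₂₂ =
      fromBlocks A.toBlocks₁₁ 0 A.toBlocks₂₁ 1 := by
    conv_lhs => rw [← fromBlocks_toBlocks A]
    rw [fromBlocks_multiply, hmul.2.1, hmul.2.2.2]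
    simp
  have h2 := congrArg det h1
  rw [det_mul, det_fromBlocks_zero₂₁, det_fromBlocks_zero₁₂, det_one, det_one, one_mul,
    mul_one] at h2
  exact h2.symm

section DualJacobiTrudi

variable {R : Type*} [CommRing R] {a b : ℤ → R}

theorem toeplitz_mul_eq_one (ha : ∀ z < 0, a z = 0) (hb : ∀ z < 0, b z = 0)
    (hab : ∀ n : ℕ, ∑ i ∈ range (n + 1), (-1) ^ i * a i * b (n - i) = if n = 0 then 1 else 0)
    (N : ℕ) :
    (Matrix.of fun x y : Fin N => a ((x : ℕ) - (y : ℕ))) *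
      (Matrix.of fun x y : Fin N => (-1) ^ ((x : ℕ) + y) * b ((x : ℕ) - (y : ℕ))) = 1 := by
  ext x z
  rw [Matrix.mul_apply, Matrix.one_apply]
  simp only [Matrix.of_apply]
  rw [Fin.sum_univ_eq_sum_range fun y : ℕ =>
    a ((x : ℕ) - (y : ℕ)) * ((-1) ^ (y + (z : ℕ)) * b ((y : ℕ) - (z : ℕ)))]
  have hIcc : Icc (z : ℕ) x ⊆ range N := fun y hy => by
    rw [mem_Icc] at hy
    rw [mem_range]
    omega
  rw [← sum_subset hIcc fun y _ hy => by
    rw [mem_Icc, not_and_or, not_le, not_le] at hy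
    rcases hy with hy | hy
    · rw [hb _ (by omega), mul_zero, mul_zero]
    · rw [ha _ (by omega), zero_mul]]
  by_cases hxz : (z : ℕ) ≤ x
  · obtain ⟨n, hn⟩ := Nat.exists_eq_add_of_le hxz
    have h1 : ∑ y ∈ Icc (z : ℕ) x,
        a ((x : ℕ) - (y : ℕ)) * ((-1) ^ (y + (z : ℕ)) * b ((y : ℕ) - (z : ℕ))) =
        ∑ i ∈ range (n + 1), (-1) ^ n * ((-1) ^ i * a i * b (n - i)) := by
      refine sum_nbij' (fun y => x - y) (fun i => x - i) ?_ ?_ ?_ ?_ ?_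
      · intro y hy
        rw [mem_Icc] at hy
        rw [mem_range]
        omega
      · intro i hi
        rw [mem_range] at hi
        rw [mem_Icc]
        omega
      · intro y hy
        rw [mem_Icc] at hy
        omega
      · intro i hi
        rw [mem_range] at hi
        omega
      · intro y hy
        rw [mem_Icc] at hy
        have e1 : (((x : ℕ) - y : ℕ) : ℤ) = (x : ℕ) - (y : ℕ) := by omega
        have e2 : (n : ℤ) - (((x : ℕ) - y : ℕ) : ℤ) = (y : ℕ) - (z : ℕ) := by omega
        have e3 : (-1 : R) ^ (y + (z : ℕ)) = (-1) ^ n * (-1) ^ ((x : ℕ) - y) := by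
          rw [← pow_add, neg_one_pow_congr]
          rw [Nat.even_iff, Nat.even_iff]
          omega
        rw [e2, e1, e3]
        ring
    rw [h1, ← mul_sum, hab]
    by_cases hxz' : x = z
    · have hn0 : n = 0 := by rw [hxz'] at hn; omega
      simp [hn0, hxz']
    · have hn0 : n ≠ 0 := fun h' => hxz' (Fin.ext (by omega))
      simp [hn0, hxz']
  · rw [Icc_eq_empty hxz, sum_empty, if_neg fun h' => hxz (by rw [h'])]

theorem det_toeplitz (ha : ∀ z < 0, a z = 0) (ha0 : a 0 = 1) (N : ℕ) :
    (Matrix.of fun x y : Fin N => a ((x : ℕ) - (y : ℕ))).det = 1 := by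
  rw [Matrix.det_of_isLowerTriangular]
  · simp [ha0]
  · intro x y hxy
    have hxy' : (x : ℕ) < y := hxy
    exact ha _ (by omega)

/-- If the generating functions `∑ (-1)ⁱ a_i tⁱ` and `∑ b_i tⁱ` are inverse to each other, then
the determinants `det(a_{μ_i - i + j})` and `det(b_{μᵗ_i - i + j})` agree, as both are complementary
minors of inverse Toeplitz matrices. The signs from Jacobi's identity cancel those
from the generating functions. -/
theorem dual_jacobiTrudi (ha : ∀ z < 0, a z = 0) (hb : ∀ z < 0, b z = 0) (ha0 : a 0 = 1)
    (hab : ∀ n : ℕ, ∑ i ∈ range (n + 1), (-1) ^ i * a i * b (n - i) = if n = 0 then 1 else 0)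
    (μ : YoungDiagram) :
    (Matrix.of fun i j : Fin (μ.colLen 0) => a ((μ.rowLen i : ℤ) - i + j)).det =
      (Matrix.of fun i j : Fin (μ.rowLen 0) => b ((μ.colLen i : ℤ) - i + j)).det := by
  set N := μ.colLen 0 + μ.rowLen 0 with hN
  let E : Matrix (Fin N) (Fin N) R := Matrix.of fun x y => a ((x : ℕ) - (y : ℕ))
  let H : Matrix (Fin N) (Fin N) R :=
    Matrix.of fun x y => (-1) ^ ((x : ℕ) + y) * b ((x : ℕ) - (y : ℕ))
  let f : Fin (μ.colLen 0) ⊕ Fin (μ.rowLen 0) ≃ Fin N := finSumFinEquiv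
  let A := (E.submatrix μ.mayaPerm id).submatrix f f
  let B := (H.submatrix id μ.mayaPerm).submatrix f f
  have hEH : E * H = 1 := toeplitz_mul_eq_one ha hb hab N
  have hAB : A * B = 1 := by
    simp only [A, B]
    rw [Matrix.submatrix_mul_equiv, Matrix.submatrix_mul _ _ _ id _ Function.bijective_id |>.symm,
      hEH, Matrix.submatrix_one_equiv, Matrix.submatrix_one_equiv]
  have hdetA : A.det = ∏ j : Fin (μ.rowLen 0), (-1) ^ μ.colLen j := by
    simp only [A]
    rw [Matrix.det_submatrix_equiv_self, Matrix.det_permute, det_toeplitz ha ha0,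
      YoungDiagram.sign_mayaPerm]
    simp
  have hA : A.toBlocks₁₁.det =
      (Matrix.of fun i j : Fin (μ.colLen 0) => a ((μ.rowLen i : ℤ) - i + j)).det := by
    rw [← Matrix.det_submatrix_equiv_self Fin.revPerm A.toBlocks₁₁]
    congr 1
    ext i j
    change a ((μ.maya (Fin.rev i) : ℕ) - ((Fin.rev j : Fin _) : ℕ)) = a _
    rw [YoungDiagram.maya, if_pos (Fin.is_lt _), Fin.val_rev, Fin.val_rev]
    have h1 : μ.colLen 0 - 1 - (μ.colLen 0 - ((i : ℕ) + 1)) = i := by omega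
    rw [h1]
    congr 1
    omega
  have hB : B.toBlocks₂₂.det = (∏ j : Fin (μ.rowLen 0), (-1) ^ μ.colLen j) *
      (Matrix.of fun i j : Fin (μ.rowLen 0) => b ((μ.colLen i : ℤ) - i + j)).det := by
    have hval : ∀ j : Fin (μ.rowLen 0), μ.maya (μ.colLen 0 + j) + μ.colLen j = μ.colLen 0 + j :=
      fun j => by
        have := μ.colLen_le j
        rw [YoungDiagram.maya, if_neg (by omega), Nat.add_sub_cancel_left]
        omega
    have hentry : B.toBlocks₂₂ = Matrix.of fun i j : Fin (μ.rowLen 0) =>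
        (-1) ^ (μ.colLen 0 + (i : ℕ)) * Matrix.of (fun i j : Fin (μ.rowLen 0) =>
          (-1) ^ (μ.maya (μ.colLen 0 + j)) *
            (Matrix.of fun i j : Fin (μ.rowLen 0) => b ((μ.colLen i : ℤ) - i + j)).transpose i j)
          i j := by
      ext i j
      change (-1) ^ ((μ.colLen 0 + i) + μ.maya (μ.colLen 0 + j)) *
        b ((μ.colLen 0 + i : ℕ) - (μ.maya (μ.colLen 0 + j) : ℕ)) =
        (-1) ^ (μ.colLen 0 + (i : ℕ)) * ((-1) ^ (μ.maya (μ.colLen 0 + j)) * b _)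
      rw [pow_add, mul_assoc]
      congr 3
      have := hval j
      omega
    rw [hentry, Matrix.det_mul_column, Matrix.det_mul_row, Matrix.det_transpose, ← mul_assoc,
      ← prod_mul_distrib]
    congr 1
    refine prod_congr rfl fun j _ => ?_
    rw [← pow_add, neg_one_pow_congr]
    have := hval j
    rw [Nat.even_iff, Nat.even_iff]
    omega
  rw [← hA, Matrix.det_toBlocks₁₁_of_mul_eq_one hAB, hdetA, hB, ← mul_assoc, ← prod_mul_distrib]
  rw [prod_eq_one fun j _ => by rw [← pow_add, Even.neg_one_pow ⟨_, rfl⟩], one_mul]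

end DualJacobiTrudi

/-! ### Elementary and complete homogeneous symmetric functions -/

open scoped Classical in
theorem coeff_symE (k : ℤ) (d : ℕ →₀ ℕ) : MvPowerSeries.coeff d (symE k) =
    if (d.degree : ℤ) = k ∧ ∀ i, d i ≤ 1 then 1 else 0 := rfl

theorem coeff_symH (k : ℤ) (d : ℕ →₀ ℕ) :
    MvPowerSeries.coeff d (symH k) = if (d.degree : ℤ) = k then 1 else 0 := rfl

theorem degree_eq_card_support {d : ℕ →₀ ℕ} (hd : ∀ i, d i ≤ 1) : d.degree = d.support.card := by
  rw [Finsupp.degree_apply, card_eq_sum_ones]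
  refine sum_congr rfl fun i hi => ?_
  have := hd i
  have := Finsupp.mem_support_iff.1 hi
  omega

/-- The squarefree divisors of a monomial correspond to the sets of its variables, so their signs
cancel unless the monomial is `1`. -/
theorem sum_antidiagonal_squarefree (d : ℕ →₀ ℕ) [DecidablePred fun p : ℕ →₀ ℕ => ∀ i, p i ≤ 1] :
    ∑ p ∈ antidiagonal d, (if ∀ i, p.1 i ≤ 1 then (-1 : ℚ) ^ p.1.degree else 0) =
      if d = 0 then 1 else 0 := by
  have h1 := sum_powerset_neg_one_pow_card (x := d.support)
  have h2 : ((∑ S ∈ d.support.powerset, (-1 : ℤ) ^ S.card : ℤ) : ℚ) = if d = 0 then 1 else 0 := by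
    rw [h1]
    simp only [Finsupp.support_eq_empty]
    split_ifs <;> simp
  rw [← h2, ← sum_filter]
  push_cast
  have hind : ∀ S ∈ d.support.powerset, Finsupp.indicator S (fun _ _ => 1) ≤ d := fun S hS i => by
    rw [Finsupp.indicator_apply]
    split_ifs with hi
    · have := Finsupp.mem_support_iff.1 (mem_powerset.1 hS hi)
      omega
    · exact Nat.zero_le _
  refine sum_nbij' (fun p => p.1.support)
    (fun S => (Finsupp.indicator S (fun _ _ => 1), d - Finsupp.indicator S (fun _ _ => 1)))
    ?_ ?_ ?_ ?_ ?_
  · intro p hp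
    rw [mem_filter, HasAntidiagonal.mem_antidiagonal] at hp
    rw [mem_powerset, ← hp.1]
    exact Finsupp.support_mono (le_self_add)
  · intro S hS
    rw [mem_filter, HasAntidiagonal.mem_antidiagonal]
    refine ⟨add_tsub_cancel_of_le (hind S hS), fun i => ?_⟩
    change Finsupp.indicator S (fun _ _ => 1) i ≤ 1
    rw [Finsupp.indicator_apply]
    split_ifs <;> simp
  · intro p hp
    rw [mem_filter, HasAntidiagonal.mem_antidiagonal] at hp
    have h3 : Finsupp.indicator p.1.support (fun _ _ => 1) = p.1 := by
      ext i
      rw [Finsupp.indicator_apply]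
      have := hp.2 i
      split_ifs with hi <;> rw [Finsupp.mem_support_iff] at hi <;> omega
    refine Prod.ext h3 ?_
    change d - Finsupp.indicator p.1.support (fun _ _ => 1) = p.2
    rw [h3, ← hp.1, add_tsub_cancel_left]
  · intro S _
    ext i
    simp [Finsupp.indicator_apply]
  · intro p hp
    rw [mem_filter] at hp
    rw [degree_eq_card_support hp.2]

/-- The generating functions of the `(-1)^i e_i` and of the `h_i` are inverse to each other. -/
theorem sum_symE_mul_symH (n : ℕ) : ∑ i ∈ range (n + 1),
    (-1) ^ i * symE i * symH (n - i) = if n = 0 then 1 else 0 := by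
  classical
  ext d
  have h1 : ∀ i : ℕ, MvPowerSeries.coeff d ((-1) ^ i * symE i * symH (n - i)) =
      ∑ p ∈ antidiagonal d, (if p.1.degree = i then
        (if (∀ i, p.1 i ≤ 1) ∧ d.degree = n then (-1 : ℚ) ^ p.1.degree else 0) else 0) := by
    intro i
    have hC : (-1 : MvPowerSeries ℕ ℚ) ^ i * symE i * symH (n - i) =
        (-1 : ℚ) ^ i • (symE i * symH (n - i)) := by
      rw [Algebra.smul_def, map_pow, map_neg, map_one, mul_assoc]
    rw [hC, map_smul, MvPowerSeries.coeff_mul, smul_eq_mul, mul_sum]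
    refine sum_congr rfl fun p hp => ?_
    rw [HasAntidiagonal.mem_antidiagonal] at hp
    have hdeg : d.degree = p.1.degree + p.2.degree := by rw [← hp, map_add]
    rw [coeff_symE, coeff_symH]
    by_cases hi : p.1.degree = i
    · subst hi
      by_cases hsq : ∀ i, p.1 i ≤ 1
      · by_cases hn : d.degree = n
        · have hq : (p.2.degree : ℤ) = n - p.1.degree := by omega
          simp [hsq, hn, hq]
        · have hq : ¬ (p.2.degree : ℤ) = n - p.1.degree := by omega
          simp [hn, hq]
      · simp [hsq]
    · rw [if_neg fun h' => hi (by exact_mod_cast h'.1), if_neg hi, zero_mul, mul_zero]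
  rw [map_sum, sum_congr rfl fun i _ => h1 i, sum_comm]
  have hR : MvPowerSeries.coeff d (if n = 0 then 1 else 0 : MvPowerSeries ℕ ℚ) =
      if d.degree = n then (if d = 0 then 1 else 0) else 0 := by
    by_cases hd : d = 0
    · subst hd
      by_cases hn : n = 0
      · simp [hn]
      · simp [hn, Ne.symm hn]
    · by_cases hn : n = 0 <;> simp [hn, hd, MvPowerSeries.coeff_one]
  rw [hR]
  by_cases hn : d.degree = n
  · rw [if_pos hn, ← sum_antidiagonal_squarefree]
    refine sum_congr rfl fun p hp => ?_
    rw [HasAntidiagonal.mem_antidiagonal] at hp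
    have hdeg : d.degree = p.1.degree + p.2.degree := by rw [← hp, map_add]
    rw [sum_ite_eq, if_pos (mem_range.2 (by omega))]
    simp only [hn, and_true]
  · rw [if_neg hn]
    refine sum_eq_zero fun p _ => sum_eq_zero fun i _ => ?_
    rw [if_neg fun h' : _ ∧ _ => hn h'.2, ite_self]

theorem symE_of_neg {k : ℤ} (hk : k < 0) : symE k = 0 := by
  ext d
  rw [coeff_symE, if_neg (fun h' => by omega), map_zero]

theorem symH_of_neg {k : ℤ} (hk : k < 0) : symH k = 0 := by
  ext d
  rw [coeff_symH, if_neg (fun h' => by omega), map_zero]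

theorem symE_zero : symE 0 = 1 := by
  classical
  ext d
  rw [coeff_symE, MvPowerSeries.coeff_one]
  refine if_congr ?_ rfl rfl
  rw [Nat.cast_eq_zero, Finsupp.degree_eq_zero_iff]
  refine and_iff_left_of_imp ?_
  rintro rfl i
  simp

theorem det_symE_eq_symSchur_transpose (μ : YoungDiagram) :
    (Matrix.of fun i j : Fin (μ.colLen 0) => symE ((μ.rowLen i : ℤ) - i + j)).det =
      symSchur μ.transpose := by
  rw [dual_jacobiTrudi (fun _ => symE_of_neg) (fun _ => symH_of_neg) symE_zero sum_symE_mul_symH,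
    symSchur]
  simp only [YoungDiagram.rowLen_transpose]
  rw [YoungDiagram.colLen_transpose]

end

theorem theorem4p4 :
    (∀ (n : ℕ) (π : SetPartition n),
      NCSym.schurTranspose π =
        NCSym.permute (NCSym.readingPerm π)
          (NCSym.ncdet (Matrix.of fun i j : Fin ((NCSym.shape π).colLen 0) =>
            NCSym.eEntry (((NCSym.shape π).rowLen i : ℤ) - i + j)))) ∧
    (LinearIndependent ℚ (fun π : Σ n, SetPartition n => NCSym.schurTranspose π.2) ∧
      Submodule.span ℚ (Set.range fun π : Σ n, SetPartition n => NCSym.schurTranspose π.2) = ⊤) ∧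
    (∀ (n : ℕ) (π : SetPartition n),
      NCSym.rho (NCSym.schurTranspose π : NCSeries) = symSchur (NCSym.shape π).transpose) :=
  ⟨fun _ π => NCSym.schurTranspose_eq π,
    NCSym.basis_of_homogeneous
      (fun _ π _ hw => NCSym.schurTranspose_apply_of_length_ne π hw)
      fun _ => NCSym.linearIndependent_schurTranspose,
    fun _ π => (NCSym.rho_schurTranspose π).trans (det_symE_eq_symSchur_transpose _)⟩
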